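/- **Theorem.** Let $E$ be a complex Banach lattice, i.e. the complexification $E = F \oplus iF$ of a real Banach lattice $F$ with modulus $|x+iy| = \sup_{\theta\in\mathbb{R}} (x\cos\theta + y\sin\theta)$ and norm $\|z\| = \|\,|z|\,\|$, and let $E_+ = F_+$ be its positive cone. Let $T$ be a bounded linear operator on $E$ with spectral radius $r(T) = 1$ which is positive ($TE_+ \subseteq E_+$) and irreducible (the only closed $T$-invariant ideals of $E$ are $\{0\}$ and $E$; an ideal is a vector subspace $I$ such that $|w| \le |z|$ and $z \in I$ imply $w \in I$). Let $\sigma(T)$ be the spectrum and $\sigma_{\mathrm{pnt}}(T)$ the point spectrum of $T$, and assume that the peripheral point spectrum $\sigma_{\mathrm{pnt}}(T) \cap \{\lambda \in \mathbb{C} : |\lambda| = r(T)\}$ of $T$ is non-empty; its elements are called the peripheral eigenvalues of $T$. Assume moreover that $T$ is (WS)-bounded: there is a net $(f_j)_{j \in J}$ of functions, each analytic on a neighbourhood of the closed unit disk, with $f_j(1) = 1$ for all $j$, with $f_j^{(k)}(0) \ge 0$ for all $j$ and all integers $k \ge 0$, and with $f_j(z) \to 0$ for all $z \in \mathbb{C}$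 with $|z| < 1$, such that $\sup_j \|f_j(T)\| < \infty$, where $f_j(T)$ is defined by the analytic functional calculus. Then the following assertions hold. (a) For every $x \in E_+$ with $x \ne 0$, $T^k x$ does not converge to $0$ as $k \to \infty$. (b) If $z \in \ker(\lambda - T)$ for a peripheral eigenvalue $\lambda$ of $T$, then $|z| \in \ker(1 - T)$. (c) $1$ is an eigenvalue of $T$, and $\ker(1 - T)$ is a one-dimensional sublattice of $E$ (a closed subspace invariant under complex conjugation and under $z \mapsto |z|$) which is spanned by a quasi-interior point of $E_+$, i.e. by some $x \in E_+$ for which $\{y \in E : |y| \le cx \text{ for some } c > 0\}$ is dense in $E$. (d) For each peripheral eigenvalue $\lambda$ of $T$ the operators $T$ and $\lambda T$ are similar, i.e. $\lambda T = V^{-1} T V$ for some bijective bounded linear operator $V$ on $E$. Moreover, $\lambda\sigma(T) = \sigma(T)$ and $\lambda\sigma_{\mathrm{pnt}}(T) = \sigma_{\mathrm{pnt}}(T)$. (e) The peripheral point spectrum of $T$ is a subgroup of the complex unit circle. (f) Each peripheral eigenvalue $\lambda$ of $T$ is algebraically simple: $\dim \bigcup_{n \in \mathbb{N}} \ker((\lambda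 - T)^n) = \dim \ker(\lambda - T) = 1$. (g) $1$ is the only eigenvalue of $T$ which admits a positive eigenvector, i.e. an eigenvector in $E_+$. -/

import Mathlib

universe u v

set_option linter.unusedSectionVars false

/-! ### Complex Banach lattices

A complex Banach lattice is the complexification `F ⊕ iF` of a real Banach lattice `F`, with modulus
`|x + iy| = sup_θ (cos θ • x + sin θ • y)` and norm `‖z‖ = ‖|z|‖`. The real Banach lattice `F` is
given by Mathlib's classes. -/

/-- The complexification `F ⊕ iF` of `F`. -/
@[ext]
structure LatticeComplexification (F : Type u) : Type u where
  re : F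
  im : F

namespace LatticeComplexification

section Algebra

variable {F : Type u} [AddCommGroup F]

instance : Zero (LatticeComplexification F) := ⟨⟨0, 0⟩⟩
instance : Add (LatticeComplexification F) := ⟨fun z w => ⟨z.re + w.re, z.im + w.im⟩⟩
instance : Neg (LatticeComplexification F) := ⟨fun z => ⟨-z.re, -z.im⟩⟩
instance : Sub (LatticeComplexification F) := ⟨fun z w => ⟨z.re - w.re, z.im - w.im⟩⟩
instance instSMulNat : SMul ℕ (LatticeComplexification F) := ⟨fun n z => ⟨n • z.re, n • z.im⟩⟩
instance instSMulInt : SMul ℤ (LatticeComplexification F) := ⟨fun n z => ⟨n • z.re, n • z.im⟩⟩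

@[simp] theorem zero_re : (0 : LatticeComplexification F).re = 0 := rfl
@[simp] theorem zero_im : (0 : LatticeComplexification F).im = 0 := rfl
@[simp] theorem add_re (z w : LatticeComplexification F) : (z + w).re = z.re + w.re := rfl
@[simp] theorem add_im (z w : LatticeComplexification F) : (z + w).im = z.im + w.im := rfl
@[simp] theorem neg_re (z : LatticeComplexification F) : (-z).re = -z.re := rfl
@[simp] theorem neg_im (z : LatticeComplexification F) : (-z).im = -z.im := rfl
@[simp] theorem sub_re (z w : LatticeComplexification F) : (z - w).re = z.re - w.re := rfl
@[simp] theorem sub_im (z w : LatticeComplexification F) : (z - w).im = z.im - w.im := rfl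

instance : AddCommGroup (LatticeComplexification F) :=
  Function.Injective.addCommGroup
    (fun z : LatticeComplexification F => ((z.re, z.im) : F × F))
    (fun _ _ h => LatticeComplexification.ext (congrArg Prod.fst h) (congrArg Prod.snd h))
    rfl (fun _ _ => rfl) (fun _ => rfl) (fun _ _ => rfl) (fun _ _ => rfl) (fun _ _ => rfl)

variable [Module ℝ F]

/-- `(a + ib)(x + iy) = (ax - by) + i(ay + bx)`. -/
instance instSMulComplex : SMul ℂ (LatticeComplexification F) :=
  ⟨fun c z => ⟨c.re • z.re - c.im • z.im, c.re • z.im + c.im • z.re⟩⟩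

@[simp] theorem smul_re (c : ℂ) (z : LatticeComplexification F) :
    (c • z).re = c.re • z.re - c.im • z.im := rfl
@[simp] theorem smul_im (c : ℂ) (z : LatticeComplexification F) :
    (c • z).im = c.re • z.im + c.im • z.re := rfl

instance : Module ℂ (LatticeComplexification F) where
  one_smul z := by ext <;> simp
  mul_smul a b z := by ext <;> simp <;> module
  smul_zero a := by ext <;> simp
  smul_add a z w := by ext <;> simp <;> abel
  add_smul a b z := by ext <;> simp <;> module
  zero_smul z := by ext <;> simp

/-- The embedding `x ↦ x + i0` of the real part. -/
def ofReal (x : F) : LatticeComplexification F := ⟨x, 0⟩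

/-- Complex conjugation `x + iy ↦ x - iy`. -/
def conj (z : LatticeComplexification F) : LatticeComplexification F := ⟨z.re, -z.im⟩

/-- `rot z θ = cos θ • x + sin θ • y` for `z = x + iy`. -/
noncomputable def rot (z : LatticeComplexification F) (θ : ℝ) : F :=
  Real.cos θ • z.re + Real.sin θ • z.im

end Algebra

section Modulus

variable {F : Type u} [NormedAddCommGroup F] [Lattice F] [HasSolidNorm F] [IsOrderedAddMonoid F]
  [NormedSpace ℝ F] [IsOrderedModule ℝ F]

theorem smul_le_abs_smul_abs (a : ℝ) (x : F) : a • x ≤ |a| • |x| := by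
  rcases le_total 0 a with h | h
  · rw [abs_of_nonneg h]
    exact smul_le_smul_of_nonneg_left (le_abs_self x) h
  · rw [abs_of_nonpos h, ← neg_smul_neg]
    exact smul_le_smul_of_nonneg_left (neg_le_abs x) (neg_nonneg.2 h)

theorem rot_le_add (z : LatticeComplexification F) (θ φ : ℝ) :
    z.rot θ ≤ z.rot φ + |θ - φ| • (|z.re| + |z.im|) := by
  have h1 : (Real.cos θ - Real.cos φ) • z.re ≤ |θ - φ| • |z.re| :=
    (smul_le_abs_smul_abs _ _).trans
      (smul_le_smul_of_nonneg_right (Real.abs_cos_sub_cos_le θ φ) (abs_nonneg _))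
  have h2 : (Real.sin θ - Real.sin φ) • z.im ≤ |θ - φ| • |z.im| :=
    (smul_le_abs_smul_abs _ _).trans
      (smul_le_smul_of_nonneg_right (Real.abs_sin_sub_sin_le θ φ) (abs_nonneg _))
  have h := add_le_add_left (add_le_add h1 h2) (z.rot φ)
  calc z.rot θ = (Real.cos θ - Real.cos φ) • z.re + (Real.sin θ - Real.sin φ) • z.im + z.rot φ := by
        simp only [rot]; module
    _ ≤ _ := h
    _ = _ := by module

variable [CompleteSpace F]

theorem exists_isLUB_rot (z : LatticeComplexification F) : ∃ m, IsLUB (Set.range z.rot) m := by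
  classical
  set w : F := |z.re| + |z.im| with hw
  have hw0 : 0 ≤ w := add_nonneg (abs_nonneg _) (abs_nonneg _)
  let δ : ℕ → ℝ := fun n => 1 / ((n : ℝ) + 1)
  have hδ0 : ∀ n, 0 ≤ δ n := fun n => by positivity
  have hδ : Filter.Tendsto δ Filter.atTop (nhds 0) := tendsto_one_div_add_atTop_nhds_zero_nat
  let s : ℕ → F := fun n =>
    (Finset.range (7 * (n + 1) + 1)).sup' ⟨0, by simp⟩ fun k => z.rot ((k : ℝ) / ((n : ℝ) + 1))
  have hs : ∀ n θ, z.rot θ ≤ s n + δ n • w := by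
    intro n θ
    have hper : Function.Periodic z.rot (2 * Real.pi) := fun t => by simp [rot]
    obtain ⟨t, ht, hEq⟩ := hper.exists_mem_Ico₀ Real.two_pi_pos θ
    rw [hEq]
    have hn : (0 : ℝ) < (n : ℝ) + 1 := by positivity
    have htn : 0 ≤ t * ((n : ℝ) + 1) := mul_nonneg ht.1 hn.le
    set k := ⌊t * ((n : ℝ) + 1)⌋₊ with hk
    have hk1 : (k : ℝ) ≤ t * ((n : ℝ) + 1) := Nat.floor_le htn
    have hk2 : t * ((n : ℝ) + 1) < k + 1 := Nat.lt_floor_add_one _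
    have hkm : k ∈ Finset.range (7 * (n + 1) + 1) := by
      have hlt : t < 7 := by have := ht.2; have := Real.pi_lt_d2; linarith
      have h1 : (k : ℝ) ≤ 7 * ((n : ℝ) + 1) := hk1.trans (by nlinarith)
      have h2 : k ≤ 7 * (n + 1) := by exact_mod_cast h1
      simp only [Finset.mem_range]; omega
    have hd : |t - (k : ℝ) / ((n : ℝ) + 1)| ≤ δ n := by
      have e : t - (k : ℝ) / ((n : ℝ) + 1) = (t * ((n : ℝ) + 1) - k) * δ n := by
        simp only [δ]; field_simp
      rw [e, abs_of_nonneg (mul_nonneg (by linarith) (hδ0 n))]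
      exact mul_le_of_le_one_left (hδ0 n) (by linarith)
    refine (rot_le_add z t ((k : ℝ) / ((n : ℝ) + 1))).trans (add_le_add ?_ ?_)
    · exact Finset.le_sup' (fun k : ℕ => z.rot ((k : ℝ) / ((n : ℝ) + 1))) hkm
    · exact smul_le_smul_of_nonneg_right hd hw0
  have hss : ∀ m n, s m ≤ s n + δ n • w := fun m n => Finset.sup'_le _ _ fun k _ => hs n _
  have hdist : ∀ m n, dist (s m) (s n) ≤ (δ m + δ n) * ‖w‖ := by
    intro m n
    have hm := smul_nonneg (hδ0 m) hw0
    have hn := smul_nonneg (hδ0 n) hw0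
    have habs : |s m - s n| ≤ |(δ m + δ n) • w| := by
      refine le_trans ?_ (le_abs_self _)
      rw [add_smul]
      refine abs_le'.2 ⟨?_, ?_⟩
      · exact (sub_le_iff_le_add'.2 (hss m n)).trans (le_add_of_nonneg_left hm)
      · rw [neg_sub]
        exact (sub_le_iff_le_add'.2 (hss n m)).trans (le_add_of_nonneg_right hn)
    have := norm_le_norm_of_abs_le_abs habs
    rwa [norm_smul, Real.norm_of_nonneg (add_nonneg (hδ0 m) (hδ0 n)), ← dist_eq_norm] at this
  have hcau : CauchySeq s := by
    rw [cauchySeq_iff_tendsto_dist_atTop_0]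
    have h1 : Filter.Tendsto (fun p : ℕ × ℕ => (δ p.1 + δ p.2) * ‖w‖) Filter.atTop (nhds 0) := by
      rw [← Filter.prod_atTop_atTop_eq]
      have := ((hδ.comp Filter.tendsto_fst).add (hδ.comp Filter.tendsto_snd) :
        Filter.Tendsto _ (Filter.atTop ×ˢ Filter.atTop : Filter (ℕ × ℕ)) _).mul_const ‖w‖
      simpa using this
    exact squeeze_zero (fun _ => dist_nonneg) (fun p => hdist p.1 p.2) h1
  obtain ⟨m, hm⟩ := cauchySeq_tendsto_of_complete hcau
  refine ⟨m, ?_, ?_⟩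
  · rintro _ ⟨θ, rfl⟩
    have h1 : Filter.Tendsto (fun n => s n + δ n • w) Filter.atTop (nhds (m + (0 : ℝ) • w)) :=
      hm.add (hδ.smul_const w)
    rw [zero_smul, add_zero] at h1
    exact ge_of_tendsto' h1 fun n => hs n θ
  · intro b hb
    exact le_of_tendsto' hm fun n => Finset.sup'_le _ _ fun k _ => hb ⟨_, rfl⟩

/-- The modulus `|x + iy| = sup_θ (cos θ • x + sin θ • y)`, as an element of the real part `F`. -/
noncomputable def modulus (z : LatticeComplexification F) : F :=
  Classical.choose (exists_isLUB_rot z)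

theorem isLUB_modulus (z : LatticeComplexification F) : IsLUB (Set.range z.rot) z.modulus :=
  Classical.choose_spec (exists_isLUB_rot z)

theorem rot_le_modulus (z : LatticeComplexification F) (θ : ℝ) : z.rot θ ≤ z.modulus :=
  (isLUB_modulus z).1 ⟨θ, rfl⟩

theorem modulus_le {z : LatticeComplexification F} {b : F} (h : ∀ θ, z.rot θ ≤ b) :
    z.modulus ≤ b :=
  (isLUB_modulus z).2 (by rintro _ ⟨θ, rfl⟩; exact h θ)

theorem abs_re_le_modulus (z : LatticeComplexification F) : |z.re| ≤ z.modulus :=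
  abs_le'.2 ⟨by simpa [rot] using rot_le_modulus z 0, by simpa [rot] using rot_le_modulus z Real.pi⟩

theorem abs_im_le_modulus (z : LatticeComplexification F) : |z.im| ≤ z.modulus :=
  abs_le'.2 ⟨by simpa [rot] using rot_le_modulus z (Real.pi / 2),
    by simpa [rot] using rot_le_modulus z (-(Real.pi / 2))⟩

theorem modulus_nonneg (z : LatticeComplexification F) : 0 ≤ z.modulus :=
  (abs_nonneg _).trans (abs_re_le_modulus z)

theorem modulus_le_abs_add_abs (z : LatticeComplexification F) :
    z.modulus ≤ |z.re| + |z.im| := by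
  refine modulus_le fun θ => add_le_add ?_ ?_
  · refine (smul_le_abs_smul_abs _ _).trans ?_
    simpa using smul_le_smul_of_nonneg_right (Real.abs_cos_le_one θ) (abs_nonneg z.re)
  · refine (smul_le_abs_smul_abs _ _).trans ?_
    simpa using smul_le_smul_of_nonneg_right (Real.abs_sin_le_one θ) (abs_nonneg z.im)

theorem modulus_add_le (z w : LatticeComplexification F) :
    (z + w).modulus ≤ z.modulus + w.modulus := by
  refine modulus_le fun θ => ?_
  have : (z + w).rot θ = z.rot θ + w.rot θ := by simp only [rot, add_re, add_im]; module
  rw [this]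
  exact add_le_add (rot_le_modulus z θ) (rot_le_modulus w θ)

theorem modulus_smul_le (c : ℂ) (z : LatticeComplexification F) :
    (c • z).modulus ≤ ‖c‖ • z.modulus := by
  refine modulus_le fun θ => ?_
  have h1 : c.re = ‖c‖ * Real.cos c.arg := (Complex.norm_mul_cos_arg c).symm
  have h2 : c.im = ‖c‖ * Real.sin c.arg := (Complex.norm_mul_sin_arg c).symm
  have : (c • z).rot θ = ‖c‖ • z.rot (θ - c.arg) := by
    simp only [rot, smul_re, smul_im, Real.cos_sub, Real.sin_sub]
    rw [h1, h2]
    module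
  rw [this]
  exact smul_le_smul_of_nonneg_left (rot_le_modulus z _) (norm_nonneg c)

theorem norm_le_norm_of_nonneg_of_le {a b : F} (ha : 0 ≤ a) (hab : a ≤ b) : ‖a‖ ≤ ‖b‖ :=
  norm_le_norm_of_abs_le_abs (by rwa [abs_of_nonneg ha, abs_of_nonneg (ha.trans hab)])

theorem modulus_neg (z : LatticeComplexification F) : (-z).modulus = z.modulus := by
  have h : ∀ w : LatticeComplexification F, (-w).modulus ≤ w.modulus := fun w => by
    simpa using modulus_smul_le (-1) w
  exact le_antisymm (h z) (by simpa using h (-z))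

/-- The norm of a complex Banach lattice is `‖z‖ = ‖|z|‖`. -/
noncomputable instance : NormedAddCommGroup (LatticeComplexification F) :=
  AddGroupNorm.toNormedAddCommGroup
    { toFun := fun z => ‖z.modulus‖
      map_zero' := by
        have : (0 : LatticeComplexification F).modulus = 0 :=
          le_antisymm (modulus_le fun θ => by simp [rot]) (modulus_nonneg _)
        rw [this, norm_zero]
      add_le' := fun z w => (norm_le_norm_of_nonneg_of_le (modulus_nonneg _)
        (modulus_add_le z w)).trans (norm_add_le _ _)
      neg' := fun z => by rw [modulus_neg]
      eq_zero_of_map_eq_zero' := fun z hz => by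
        have h0 : z.modulus = 0 := norm_eq_zero.1 hz
        have h1 : |z.re| ≤ |(0 : F)| := by simpa [h0] using abs_re_le_modulus z
        have h2 : |z.im| ≤ |(0 : F)| := by simpa [h0] using abs_im_le_modulus z
        have h1' := norm_le_norm_of_abs_le_abs h1
        have h2' := norm_le_norm_of_abs_le_abs h2
        rw [norm_zero] at h1' h2'
        exact LatticeComplexification.ext (norm_le_zero_iff.1 h1') (norm_le_zero_iff.1 h2') }

theorem norm_eq (z : LatticeComplexification F) : ‖z‖ = ‖z.modulus‖ := rfl

noncomputable instance : NormedSpace ℂ (LatticeComplexification F) where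
  norm_smul_le c z := by
    have h : ‖(c • z).modulus‖ ≤ ‖‖c‖ • z.modulus‖ :=
      norm_le_norm_of_nonneg_of_le (modulus_nonneg _) (modulus_smul_le c z)
    have h' : ‖‖c‖ • z.modulus‖ = ‖c‖ * ‖z.modulus‖ := by rw [norm_smul, norm_norm]
    rw [norm_eq, norm_eq]
    exact h.trans_eq h'

theorem norm_re_le (z : LatticeComplexification F) : ‖z.re‖ ≤ ‖z‖ :=
  norm_le_norm_of_abs_le_abs
    (by rw [abs_of_nonneg (modulus_nonneg z)]; exact abs_re_le_modulus z)

theorem norm_im_le (z : LatticeComplexification F) : ‖z.im‖ ≤ ‖z‖ :=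
  norm_le_norm_of_abs_le_abs
    (by rw [abs_of_nonneg (modulus_nonneg z)]; exact abs_im_le_modulus z)

theorem norm_le_add (z : LatticeComplexification F) : ‖z‖ ≤ ‖z.re‖ + ‖z.im‖ := by
  have h := (norm_le_norm_of_nonneg_of_le (modulus_nonneg z) (modulus_le_abs_add_abs z)).trans
    (norm_add_le _ _)
  rwa [norm_abs_eq_norm, norm_abs_eq_norm] at h

theorem dist_re_le (z w : LatticeComplexification F) : dist z.re w.re ≤ dist z w := by
  have h := norm_re_le (z - w)
  rw [sub_re] at h
  rw [dist_eq_norm z w, dist_eq_norm z.re w.re]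
  exact h

theorem dist_im_le (z w : LatticeComplexification F) : dist z.im w.im ≤ dist z w := by
  have h := norm_im_le (z - w)
  rw [sub_im] at h
  rw [dist_eq_norm z w, dist_eq_norm z.im w.im]
  exact h

theorem dist_le_add (z w : LatticeComplexification F) :
    dist z w ≤ dist z.re w.re + dist z.im w.im := by
  have h := norm_le_add (z - w)
  rw [sub_re, sub_im] at h
  rw [dist_eq_norm z w, dist_eq_norm z.re w.re, dist_eq_norm z.im w.im]
  exact h

instance : CompleteSpace (LatticeComplexification F) := by
  refine Metric.complete_of_cauchySeq_tendsto fun s hs => ?_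
  rw [Metric.cauchySeq_iff] at hs
  have hre : CauchySeq fun n => (s n).re := by
    rw [Metric.cauchySeq_iff]
    intro ε hε
    obtain ⟨N, hN⟩ := hs ε hε
    exact ⟨N, fun m hm n hn => (dist_re_le (s m) (s n)).trans_lt (hN m hm n hn)⟩
  have him : CauchySeq fun n => (s n).im := by
    rw [Metric.cauchySeq_iff]
    intro ε hε
    obtain ⟨N, hN⟩ := hs ε hε
    exact ⟨N, fun m hm n hn => (dist_im_le (s m) (s n)).trans_lt (hN m hm n hn)⟩
  obtain ⟨x, hx⟩ := cauchySeq_tendsto_of_complete hre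
  obtain ⟨y, hy⟩ := cauchySeq_tendsto_of_complete him
  refine ⟨⟨x, y⟩, ?_⟩
  rw [tendsto_iff_dist_tendsto_zero] at hx hy ⊢
  have h := hx.add hy
  rw [add_zero] at h
  exact squeeze_zero (fun _ => dist_nonneg) (fun n => dist_le_add (s n) ⟨x, y⟩) h

/-- `0 ≤ z`: the element `z` lies in the real part and is positive there. -/
def Nonneg (z : LatticeComplexification F) : Prop := z.im = 0 ∧ 0 ≤ z.re

/-- `0 < z`. -/
def Pos (z : LatticeComplexification F) : Prop := Nonneg z ∧ z ≠ 0

/-- An ideal: a vector subspace `I` such that `|w| ≤ |z|` and `z ∈ I` imply `w ∈ I`. -/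
def IsIdeal (I : Submodule ℂ (LatticeComplexification F)) : Prop :=
  ∀ z ∈ I, ∀ w : LatticeComplexification F, w.modulus ≤ z.modulus → w ∈ I

/-- A sublattice: a closed conjugation invariant subspace that contains `|z|` along with `z`. -/
def IsSublattice (G : Submodule ℂ (LatticeComplexification F)) : Prop :=
  IsClosed (G : Set (LatticeComplexification F)) ∧
    (∀ z ∈ G, conj z ∈ G) ∧ ∀ z ∈ G, ofReal z.modulus ∈ G

/-- A quasi-interior point of the positive cone: a positive element `x` whose principal ideal
`{y | ∃ c > 0, |y| ≤ c x}` is dense. -/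
def IsQuasiInterior (x : LatticeComplexification F) : Prop :=
  Nonneg x ∧ Dense {y : LatticeComplexification F | ∃ c : ℝ, 0 < c ∧ y.modulus ≤ c • x.re}

/-- A positive operator. -/
def IsPositiveOperator
    (T : LatticeComplexification F →L[ℂ] LatticeComplexification F) : Prop :=
  ∀ z, Nonneg z → Nonneg (T z)

/-- An irreducible operator: the only closed invariant ideals are the zero ideal and the whole
space. -/
def IsIrreducibleOperator
    (T : LatticeComplexification F →L[ℂ] LatticeComplexification F) : Prop :=
  ∀ I : Submodule ℂ (LatticeComplexification F),
    IsClosed (I : Set (LatticeComplexification F)) → IsIdeal I → (∀ z ∈ I, T z ∈ I) →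
      I = ⊥ ∨ I = ⊤

end Modulus

end LatticeComplexification

/-! ### Spectral notions and (WS)-boundedness on complex Banach spaces -/

section Spectral

variable {X : Type u} [NormedAddCommGroup X] [NormedSpace ℂ X]

/-- The point spectrum, i.e. the set of eigenvalues. -/
def pointSpectrum (T : X →L[ℂ] X) : Set ℂ :=
  {μ | Module.End.HasEigenvalue (T : X →ₗ[ℂ] X) μ}

/-- The peripheral spectrum: the spectral values whose modulus is the spectral radius. -/
def peripheralSpectrum (T : X →L[ℂ] X) : Set ℂ :=
  {μ | μ ∈ spectrum ℂ T ∧ ENNReal.ofReal ‖μ‖ = spectralRadius ℂ T}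

/-- The peripheral point spectrum, i.e. the set of peripheral eigenvalues. -/
def peripheralPointSpectrum (T : X →L[ℂ] X) : Set ℂ :=
  peripheralSpectrum T ∩ pointSpectrum T

/-- A weighting scheme: a net of functions analytic on a neighbourhood of the closed unit disk with
`f j 1 = 1`, with non-negative Taylor coefficients at `0`, and with `f j z → 0` for `‖z‖ < 1`. -/
structure IsWeightingScheme {J : Type v} [Preorder J] (f : J → ℂ → ℂ) : Prop where
  analytic : ∀ j, AnalyticOnNhd ℂ (f j) (Metric.closedBall 0 1)
  map_one : ∀ j, f j 1 = 1
  deriv_nonneg : ∀ j k, ∃ a : ℝ, 0 ≤ a ∧ iteratedDeriv k (f j) 0 = (a : ℂ)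
  tendsto_zero : ∀ z : ℂ, ‖z‖ < 1 → Filter.Tendsto (fun j => ‖f j z‖) Filter.atTop (nhds 0)

/-- `S = f(T)` in the sense of the analytic functional calculus
`f(T) = (2πi)⁻¹ ∮ f(z) (z - T)⁻¹ dz`, where the contour is a circle `|z| = R` with `R > r(T)` and
`f` is analytic on a neighbourhood of the closed disk that it bounds. -/
def IsAnalyticCalculus (f : ℂ → ℂ) (T S : X →L[ℂ] X) : Prop :=
  ∃ R : ℝ, spectralRadius ℂ T < ENNReal.ofReal R ∧
    AnalyticOnNhd ℂ f (Metric.closedBall 0 R) ∧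
      S = (2 * (Real.pi : ℂ) * Complex.I)⁻¹ • ∮ z in C(0, R), f z • resolvent T z

/-- (WS)-boundedness of an operator of spectral radius `1`: for some weighting scheme, indexed by a
nonempty directed set, the operators `f j (T)` are bounded in norm. -/
def IsWSBounded (T : X →L[ℂ] X) : Prop :=
  ∃ (J : Type v) (_ : Preorder J) (_ : IsDirectedOrder J) (_ : Nonempty J) (f : J → ℂ → ℂ),
    IsWeightingScheme f ∧ ∃ C : ℝ, ∀ j, ∃ S, IsAnalyticCalculus (f j) T S ∧ ‖S‖ ≤ C

/-- Similarity of bounded operators: `T = V⁻¹ S V` for an invertible bounded operator `V`. -/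
def AreSimilar (S T : X →L[ℂ] X) : Prop :=
  ∃ V : X ≃L[ℂ] X, T = (V.symm : X →L[ℂ] X) ∘L S ∘L (V : X →L[ℂ] X)

end Spectral

/-! (WS)-boundedness enters through a single averaging property. The Taylor coefficients of `f j`
are non-negative with sum `f j 1 = 1`, and `f j → 0` inside the disk pushes their mass to high
powers. Cutting out disjoint finite windows and gluing them gives, for every `N`, weights `0 ≤ a k ≤
1` of total mass `N` such that `∑ a k T^k` has norm at most `N * C` on the positive cone
(`HasSpreadAverages`). Since the weights are at most one, indices below `n` carry mass at most `n`.

Let `x ≥ 0` be nonzero with `x ≤ T x`. Its averages dominate `N x`. The positive `u` whose averages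
are `o(N)` form a closed invariant hereditary cone, so by irreducibility this cone contains no
nonzero vector; otherwise it would contain `x`. Orbits tending to zero lie in it, which gives (a).
So does `T x - x`, by telescoping along the bounded orbit of `x`; hence subfixed positive vectors
are fixed. This gives (b), because the modulus of a peripheral eigenvector is subfixed. Fixed
vectors then form a lattice whose nonzero positive elements are quasi-interior, hence a line, which
is (c). An eigenvalue in `[0, 1)` with a positive eigenvector would contradict (a), whence (g).

For (d), let `T z = μ z` with `|μ| = 1` and `x = |z|`. In the order ideal of `x` the real lattice
homomorphisms normalized at `x` act as points of a function space with unit `x`, and `z` becomes a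
unimodular function. For such a character `φ`, the positive normalized functional `φ ∘ T` has
modulus one at `z`, hence is multiplicative with respect to `z`. Thus multiplication `V` by `z`
satisfies `T V = μ V T`; being isometric on a dense ideal, it extends to the whole space. The
symmetry under multiplication by `μ` gives (e) and carries the fixed line onto the eigenspace of
`μ`. A Jordan chain would make an orbit grow linearly, which the averages forbid; this completes
(f). -/

/-! ### The analytic functional calculus as a power series in the operator -/

section AnalyticCalculus

open Filter Topology Complex

variable {X : Type u} [NormedAddCommGroup X] [NormedSpace ℂ X] [CompleteSpace X]

/-- Above the spectral radius the powers of an operator decay geometrically. -/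
theorem summable_norm_pow_mul_inv_pow {T : X →L[ℂ] X} {R : ℝ}
    (hR : spectralRadius ℂ T < ENNReal.ofReal R) :
    Summable fun n : ℕ => ‖T ^ n‖ * (R⁻¹) ^ n := by
  obtain ⟨r, hr0, hr1, hr2⟩ := ENNReal.lt_iff_exists_real_btwn.1 hR
  have hR0 : 0 < R := by
    by_contra h
    rw [ENNReal.ofReal_of_nonpos (not_lt.1 h)] at hR
    exact not_lt_bot hR
  have hrR : r < R := (ENNReal.ofReal_lt_ofReal_iff hR0).1 hr2
  have hq0 : 0 ≤ r / R := div_nonneg hr0 hR0.le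
  have hev : ∀ᶠ n : ℕ in atTop, ‖T ^ n‖ * (R⁻¹) ^ n ≤ (r / R) ^ n := by
    have h1 := (spectrum.pow_norm_pow_one_div_tendsto_nhds_spectralRadius T).eventually
      (gt_mem_nhds hr1)
    filter_upwards [h1, eventually_gt_atTop 0] with n hn hn0
    have h2 : ‖T ^ n‖ ^ (1 / n : ℝ) ≤ r := by
      by_contra h
      exact absurd hn (not_lt.2 (ENNReal.ofReal_le_ofReal (not_le.1 h).le))
    have h3 : ‖T ^ n‖ ≤ r ^ n := by
      have := pow_le_pow_left₀ (Real.rpow_nonneg (norm_nonneg _) _) h2 n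
      rwa [one_div, Real.rpow_inv_natCast_pow (norm_nonneg _) hn0.ne'] at this
    rw [div_eq_mul_inv, mul_pow]
    exact mul_le_mul_of_nonneg_right h3 (by positivity)
  refine Summable.of_norm_bounded_eventually_nat
    (summable_geometric_of_lt_one hq0 ((div_lt_one hR0).2 hrR)) ?_
  filter_upwards [hev] with n hn
  rwa [Real.norm_of_nonneg (by positivity)]

/-- The Neumann series of the resolvent outside the spectral radius. -/
theorem hasSum_resolvent {T : X →L[ℂ] X} {R : ℝ} (hR : spectralRadius ℂ T < ENNReal.ofReal R)
    {z : ℂ} (hz : ‖z‖ = R) (hz0 : z ≠ 0) :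
    HasSum (fun n : ℕ => (z ^ (n + 1))⁻¹ • T ^ n) (resolvent T z) := by
  have hs : Summable fun n : ℕ => (z⁻¹ • T) ^ n := by
    refine Summable.of_norm ((summable_norm_pow_mul_inv_pow hR).congr fun n => ?_)
    rw [smul_pow, norm_smul, norm_pow z⁻¹, norm_inv, hz, mul_comm]
  have h1 := hs.tsum_pow_mul_one_sub
  have h2 := hs.one_sub_mul_tsum_pow
  set A := ∑' n : ℕ, (z⁻¹ • T) ^ n with hA
  have hzT : algebraMap ℂ (X →L[ℂ] X) z - T = z • (1 - z⁻¹ • T) := by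
    rw [smul_sub, smul_smul, mul_inv_cancel₀ hz0, one_smul, Algebra.algebraMap_eq_smul_one]
  have hres : resolvent T z = z⁻¹ • A := by
    have hu : (algebraMap ℂ (X →L[ℂ] X) z - T) * (z⁻¹ • A) = 1 := by
      rw [hzT, smul_mul_smul_comm, mul_inv_cancel₀ hz0, h2, one_smul]
    have hu' : (z⁻¹ • A) * (algebraMap ℂ (X →L[ℂ] X) z - T) = 1 := by
      rw [hzT, smul_mul_smul_comm, inv_mul_cancel₀ hz0, h1, one_smul]
    exact Ring.inverse_unit ⟨_, _, hu, hu'⟩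
  rw [hres]
  convert! hs.hasSum.const_smul z⁻¹ using 2 with n
  rw [smul_pow, smul_smul, pow_succ', mul_inv, inv_pow]

/-- The analytic functional calculus is given by the Taylor series at `0`. -/
theorem IsAnalyticCalculus.hasSum {f : ℂ → ℂ} {T S : X →L[ℂ] X} (h : IsAnalyticCalculus f T S) :
    HasSum (fun n : ℕ => ((n.factorial : ℂ)⁻¹ * iteratedDeriv n f 0) • T ^ n) S := by
  obtain ⟨R, hR, hf, rfl⟩ := h
  have hR0 : 0 < R := by
    by_contra h
    rw [ENNReal.ofReal_of_nonpos (not_lt.1 h)] at hR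
    exact not_lt_bot hR
  have hcont : ContinuousOn f (Metric.closedBall 0 R) := hf.continuousOn
  obtain ⟨M, hM⟩ := (isCompact_closedBall (0 : ℂ) R).exists_bound_of_continuousOn hcont
  have hcirc : ∀ θ, circleMap 0 R θ ∈ Metric.closedBall (0 : ℂ) R := fun θ =>
    circleMap_mem_closedBall 0 hR0.le θ
  have hnorm : ∀ θ, ‖circleMap 0 R θ‖ = R := fun θ => by simp [abs_of_pos hR0]
  have hne : ∀ θ, circleMap 0 R θ ≠ 0 := fun θ => circleMap_ne_center hR0.ne'
  have hfc : Continuous fun θ => f (circleMap 0 R θ) :=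
    hcont.comp_continuous (continuous_circleMap 0 R) hcirc
  have hM0 : 0 ≤ M := (norm_nonneg _).trans (hM _ (hcirc 0))
  have key : HasSum (fun n : ℕ => ∮ z in C(0, R), f z • ((z ^ (n + 1))⁻¹ • T ^ n))
      (∮ z in C(0, R), f z • resolvent T z) := by
    refine intervalIntegral.hasSum_integral_of_dominated_convergence
      (fun n _ => M * (‖T ^ n‖ * (R⁻¹) ^ n)) (fun n => ?_) (fun n => ?_) ?_ ?_ ?_
    · refine Continuous.aestronglyMeasurable ?_
      simp only [deriv_circleMap]
      have hp : Continuous fun θ => (circleMap 0 R θ ^ (n + 1))⁻¹ :=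
        ((continuous_circleMap 0 R).pow _).inv₀ fun θ => pow_ne_zero _ (hne θ)
      exact ((continuous_circleMap 0 R).mul continuous_const).smul
        (hfc.smul (hp.smul continuous_const))
    · refine Eventually.of_forall fun θ _ => ?_
      -- The factor `R` from the derivative of the parametrization cancels one of the `n + 1`
      -- factors `R⁻¹`, which leaves the summable bound.
      rw [norm_smul, norm_smul, norm_smul, deriv_circleMap, norm_mul, norm_inv, norm_pow, hnorm,
        Complex.norm_I, mul_one, pow_succ', mul_inv]
      have h1 := hM _ (hcirc θ)
      calc R * (‖f (circleMap 0 R θ)‖ * (R⁻¹ * (R ^ n)⁻¹ * ‖T ^ n‖))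
          = ‖f (circleMap 0 R θ)‖ * (‖T ^ n‖ * (R⁻¹) ^ n) := by
            rw [inv_pow]; field_simp
        _ ≤ _ := mul_le_mul_of_nonneg_right h1 (by positivity)
    · exact Eventually.of_forall fun _ _ => (summable_norm_pow_mul_inv_pow hR).mul_left M
    · exact intervalIntegrable_const
    · exact Eventually.of_forall fun θ _ =>
        ((hasSum_resolvent hR (hnorm θ) (hne θ)).const_smul _).const_smul _
  have hint : ∀ n : ℕ, (∮ z in C(0, R), f z • ((z ^ (n + 1))⁻¹ • T ^ n)) =
      ((2 * (Real.pi : ℂ) * I / n.factorial) * iteratedDeriv n f 0) • T ^ n := by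
    intro n
    -- Cauchy's formula for derivatives evaluates the scalar integral; the constant operator `T ^ n`
    -- is pulled out.
    have hd : DiffContOnCl ℂ f (Metric.ball 0 R) :=
      (hf.differentiableOn.mono Metric.closure_ball_subset_closedBall).diffContOnCl
    have h1 := hd.circleIntegral_one_div_sub_center_pow_smul hR0 n
    rw [smul_eq_mul] at h1
    have h2 := circleIntegral.integral_smul_const
      (fun z : ℂ => (1 / (z - 0) ^ (n + 1)) • f z) (T ^ n) 0 R
    rw [h1] at h2
    rw [← h2]
    congr 1
    ext z : 1
    rw [smul_smul, sub_zero, smul_eq_mul, one_div, mul_comm]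
  simp only [hint] at key
  convert! key.const_smul (2 * (Real.pi : ℂ) * I)⁻¹ using 2 with n
  rw [smul_smul]
  congr 1
  have := Complex.two_pi_I_ne_zero
  have h3 := Nat.cast_ne_zero (R := ℂ).2 n.factorial_ne_zero
  field_simp

end AnalyticCalculus

/-! ### Positive operators on the real part, and the averages supplied by (WS)-boundedness -/

namespace LatticeComplexification

section RealPart

open Filter Topology

variable {F : Type u} [NormedAddCommGroup F] [Lattice F] [HasSolidNorm F] [IsOrderedAddMonoid F]
  [NormedSpace ℝ F] [IsOrderedModule ℝ F] [CompleteSpace F]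

@[simp] theorem ofReal_re (x : F) : (ofReal x).re = x := rfl
@[simp] theorem ofReal_im (x : F) : (ofReal x).im = 0 := rfl

theorem norm_ofReal_le (x : F) : ‖ofReal x‖ ≤ ‖x‖ := by
  simpa using norm_le_add (ofReal x)

theorem nonneg_ofReal {x : F} (hx : 0 ≤ x) : Nonneg (ofReal x) := ⟨rfl, hx⟩

/-- The real part of the restriction of an operator to the real subspace. -/
noncomputable def realPart (T : LatticeComplexification F →L[ℂ] LatticeComplexification F) :
    F →L[ℝ] F :=
  LinearMap.mkContinuous
    { toFun := fun x => (T (ofReal x)).re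
      map_add' := fun x y => by
        have : ofReal (x + y) = ofReal x + ofReal y := by ext <;> simp
        rw [this, map_add, add_re]
      map_smul' := fun c x => by
        have : ofReal (c • x) = (c : ℂ) • ofReal x := by
          ext
          · rw [smul_re]; simp
          · rw [smul_im]; simp
        rw [this, map_smul, smul_re]
        simp } ‖T‖ fun x =>
      (norm_re_le _).trans ((T.le_opNorm _).trans
        (mul_le_mul_of_nonneg_left (norm_ofReal_le x) (norm_nonneg _)))

variable {T : LatticeComplexification F →L[ℂ] LatticeComplexification F}

theorem realPart_nonneg (hT : IsPositiveOperator T) {x : F} (hx : 0 ≤ x) : 0 ≤ realPart T x :=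
  (hT _ (nonneg_ofReal hx)).2

/-- Positivity gives real values only on the cone; the decomposition into positive and negative
parts carries this over to all real vectors. -/
theorem apply_ofReal (hT : IsPositiveOperator T) (x : F) :
    T (ofReal x) = ofReal (realPart T x) := by
  refine LatticeComplexification.ext rfl ?_
  have h : ofReal x = ofReal x⁺ - ofReal x⁻ := by ext <;> simp
  rw [h, map_sub, sub_im, (hT _ (nonneg_ofReal (posPart_nonneg x))).1,
    (hT _ (nonneg_ofReal (negPart_nonneg x))).1, sub_zero, ofReal_im]

theorem eq_ofReal_add (z : LatticeComplexification F) :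
    z = ofReal z.re + Complex.I • ofReal z.im := by
  ext <;> simp

theorem apply_eq (hT : IsPositiveOperator T) (z : LatticeComplexification F) :
    T z = ⟨realPart T z.re, realPart T z.im⟩ := by
  conv_lhs => rw [eq_ofReal_add z]
  rw [map_add, map_smul, apply_ofReal hT, apply_ofReal hT]
  ext <;> simp

theorem pow_apply_eq (hT : IsPositiveOperator T) (n : ℕ) (z : LatticeComplexification F) :
    (T ^ n) z = ⟨(realPart T ^ n) z.re, (realPart T ^ n) z.im⟩ := by
  induction n with
  | zero => rfl
  | succ n ih =>
    rw [pow_succ', pow_succ', mul_apply_eq_comp, ih, apply_eq hT]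
    rfl

theorem pow_nonneg_of_nonneg {R : F →L[ℝ] F} (hR : ∀ u, 0 ≤ u → 0 ≤ R u) (n : ℕ) {u : F}
    (hu : 0 ≤ u) : 0 ≤ (R ^ n) u := by
  induction n with
  | zero => simpa
  | succ n ih =>
    rw [pow_succ', mul_apply_eq_comp]
    exact hR _ ih

theorem map_mono_of_nonneg {R : F →L[ℝ] F} (hR : ∀ u, 0 ≤ u → 0 ≤ R u) {u w : F} (h : u ≤ w) :
    R u ≤ R w := by
  have := hR _ (sub_nonneg.2 h)
  rwa [map_sub, sub_nonneg] at this

theorem pow_mono_of_nonneg {R : F →L[ℝ] F} (hR : ∀ u, 0 ≤ u → 0 ≤ R u) (n : ℕ) {u w : F}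
    (h : u ≤ w) : (R ^ n) u ≤ (R ^ n) w :=
  map_mono_of_nonneg (fun _ => pow_nonneg_of_nonneg hR n) h

/-- `R` commutes with each rotation, and each rotation lies below the modulus; monotonicity does the
rest. -/
theorem modulus_map_le {R : F →L[ℝ] F} (hR : ∀ u, 0 ≤ u → 0 ≤ R u)
    (z : LatticeComplexification F) : modulus ⟨R z.re, R z.im⟩ ≤ R z.modulus := by
  refine modulus_le fun θ => ?_
  have : rot ⟨R z.re, R z.im⟩ θ = R (z.rot θ) := by simp [rot]
  rw [this]
  exact map_mono_of_nonneg hR (rot_le_modulus z θ)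

/-- The averaging property of a positive operator that (WS)-boundedness provides: for every `N` some
sum `∑ a k • R ^ k` with coefficients in `[0, 1]` of total mass `N` is bounded by `N * C`. -/
def HasSpreadAverages (R : F →L[ℝ] F) : Prop :=
  ∃ C : ℝ, 0 ≤ C ∧ ∀ N : ℕ, ∃ (L : ℕ) (a : ℕ → ℝ), (∀ k, 0 ≤ a k) ∧ (∀ k, a k ≤ 1) ∧
    ∑ k ∈ Finset.range L, a k = N ∧
    ∀ u, 0 ≤ u → ‖∑ k ∈ Finset.range L, a k • (R ^ k) u‖ ≤ N * C * ‖u‖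

/-- The total mass is the value at `1`, which lies inside the disk of radius `R > 1`. The initial
mass is controlled by the value at `1 / 2`: for `k < K` one has `1 ≤ 2 ^ K * (1 / 2) ^ k`, and the
remaining terms of the series are non-negative. -/
theorem _root_.IsWeightingScheme.exists_coeff {J : Type v} [Preorder J] {f : J → ℂ → ℂ}
    (hf : IsWeightingScheme f) (j : J) (R : ℝ) (hR : 1 < R)
    (hfR : AnalyticOnNhd ℂ (f j) (Metric.closedBall 0 R)) :
    ∃ a : ℕ → ℝ, (∀ k, 0 ≤ a k) ∧
      (∀ k : ℕ, ((k.factorial : ℂ)⁻¹ * iteratedDeriv k (f j) 0) = a k) ∧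
      HasSum a 1 ∧ ∀ K : ℕ, ∑ k ∈ Finset.range K, a k ≤ 2 ^ K * ‖f j (1 / 2)‖ := by
  choose b hb0 hb using hf.deriv_nonneg j
  set a : ℕ → ℝ := fun k => (k.factorial : ℝ)⁻¹ * b k with ha
  have ha0 : ∀ k, 0 ≤ a k := fun k => mul_nonneg (by positivity) (hb0 k)
  have hac : ∀ k : ℕ, ((k.factorial : ℂ)⁻¹ * iteratedDeriv k (f j) 0) = a k := fun k => by
    rw [hb k, ha]; push_cast; rfl
  have hd : DifferentiableOn ℂ (f j) (Metric.ball 0 R) :=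
    hfR.differentiableOn.mono Metric.ball_subset_closedBall
  have hsum : ∀ r : ℝ, 0 ≤ r → r < R → HasSum (fun k => ((a k * r ^ k : ℝ) : ℂ)) (f j r) := by
    intro r hr0 hr
    have h := Complex.hasSum_taylorSeries_on_ball hd (z := (r : ℂ))
      (by simpa [abs_of_nonneg hr0] using hr)
    refine h.congr_fun ?_
    intro k
    rw [smul_eq_mul, smul_eq_mul, sub_zero]
    push_cast
    rw [← hac k]; ring
  refine ⟨a, ha0, hac, ?_, fun K => ?_⟩
  · have h := hsum 1 zero_le_one hR
    rw [Complex.ofReal_one, hf.map_one j, ← Complex.ofReal_one, Complex.hasSum_ofReal] at h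
    simpa using h
  · have h := hsum (1 / 2) (by norm_num) (by linarith)
    have h1 := Complex.hasSum_re h
    simp only [Complex.ofReal_re] at h1
    have h2 : (f j ((1 / 2 : ℝ) : ℂ)).re ≤ ‖f j (1 / 2)‖ := by
      have := Complex.re_le_norm (f j ((1 / 2 : ℝ) : ℂ))
      simpa using this
    have h3 := (sum_le_hasSum (Finset.range K) (fun k _ => by have := ha0 k; positivity) h1).trans h2
    calc ∑ k ∈ Finset.range K, a k ≤ ∑ k ∈ Finset.range K, 2 ^ K * (a k * (1 / 2) ^ k) := by
          refine Finset.sum_le_sum fun k hk => ?_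
          have h4 : (1 : ℝ) ≤ 2 ^ K * (1 / 2) ^ k := by
            rw [one_div, inv_pow, ← div_eq_mul_inv, one_le_div (by positivity)]
            exact pow_le_pow_right₀ (by norm_num) (Finset.mem_range.1 hk).le
          have := mul_le_mul_of_nonneg_left h4 (ha0 k)
          linarith
      _ = 2 ^ K * ∑ k ∈ Finset.range K, a k * (1 / 2) ^ k := by rw [Finset.mul_sum]
      _ ≤ _ := mul_le_mul_of_nonneg_left h3 (by positivity)

/-- If `f j (1 / 2)` is small, the powers below `K` carry mass at most `1 / 4`; cutting the tail at
`L` leaves a window of mass at least `1 / 2`. By positivity the windowed sum is dominated by the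
full series `f j (T) u`, and normalizing the window costs a factor of at most `2`. -/
theorem exists_late_average (hr : spectralRadius ℂ T = 1) (hT : IsPositiveOperator T)
    (hWS : IsWSBounded.{u, v} T) :
    ∃ C : ℝ, 0 ≤ C ∧ ∀ K : ℕ, ∃ (L : ℕ) (a : ℕ → ℝ), (∀ k, 0 ≤ a k) ∧
      ∑ k ∈ Finset.Ico K L, a k = 1 ∧
      ∀ u, 0 ≤ u → ‖∑ k ∈ Finset.Ico K L, a k • (realPart T ^ k) u‖ ≤ C * ‖u‖ := by
  obtain ⟨J, _, _, _, f, hf, C, hC⟩ := hWS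
  have hpos : ∀ u : F, 0 ≤ u → 0 ≤ realPart T u := fun _ => realPart_nonneg hT
  refine ⟨2 * |C|, by positivity, fun K => ?_⟩
  have hlim := hf.tendsto_zero (1 / 2) (by norm_num)
  have hε : (0 : ℝ) < 1 / (4 * 2 ^ K) := by positivity
  obtain ⟨j, hj⟩ := (hlim.eventually (gt_mem_nhds hε)).exists
  obtain ⟨S, hS, hSC⟩ := hC j
  have hsum := hS.hasSum
  obtain ⟨R, hR, hfR, -⟩ := hS
  rw [hr, ← ENNReal.ofReal_one, ENNReal.ofReal_lt_ofReal_iff_of_nonneg zero_le_one] at hR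
  obtain ⟨a, ha0, hac, ha1, haK⟩ := hf.exists_coeff j R hR hfR
  have hK : ∑ k ∈ Finset.range K, a k ≤ 1 / 4 := by
    refine (haK K).trans ?_
    calc (2 : ℝ) ^ K * ‖f j (1 / 2)‖ ≤ 2 ^ K * (1 / (4 * 2 ^ K)) :=
          mul_le_mul_of_nonneg_left hj.le (by positivity)
      _ = 1 / 4 := by field_simp
  obtain ⟨L, hL1, hKL⟩ := ((ha1.tendsto_sum_nat.eventually
    (lt_mem_nhds (show (3 / 4 : ℝ) < 1 by norm_num))).and (eventually_ge_atTop K)).exists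
  set s := ∑ k ∈ Finset.Ico K L, a k with hs
  have hs2 : 1 / 2 ≤ s := by
    rw [hs, Finset.sum_Ico_eq_sub _ hKL]
    linarith
  refine ⟨L, fun k => s⁻¹ * a k, fun k => mul_nonneg (by positivity) (ha0 k), ?_, fun u hu => ?_⟩
  · rw [← Finset.mul_sum]
    exact inv_mul_cancel₀ (by positivity)
  · have h1 : HasSum (fun k => a k • (realPart T ^ k) u) (S (ofReal u)).re := by
      have h2 := (ContinuousLinearMap.apply ℂ _ (ofReal u)).hasSum hsum
      have hre : Continuous (fun z : LatticeComplexification F => z.re) :=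
        LipschitzWith.continuous (K := 1) (LipschitzWith.of_dist_le_mul fun z w => by
          simpa using dist_re_le z w)
      have h3 := h2.map (AddMonoidHom.mk' (fun z : LatticeComplexification F => z.re)
        fun _ _ => rfl) hre
      convert! h3 using 2 with k
      simp only [Function.comp, hac]
      change _ = (((a k : ℂ) • (T ^ k)) (ofReal u)).re
      rw [smul_apply, pow_apply_eq hT, smul_re]
      simp
    have hnn : ∀ k, 0 ≤ a k • (realPart T ^ k) u := fun k =>
      smul_nonneg (ha0 k) (pow_nonneg_of_nonneg hpos k hu)
    have h4 := sum_le_hasSum (Finset.Ico K L) (fun k _ => hnn k) h1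
    have h5 := norm_le_norm_of_nonneg_of_le (Finset.sum_nonneg fun k _ => hnn k) h4
    have h6 : ‖(S (ofReal u)).re‖ ≤ |C| * ‖u‖ :=
      (norm_re_le _).trans ((S.le_opNorm _).trans (mul_le_mul (hSC.trans (le_abs_self C))
        (norm_ofReal_le u) (norm_nonneg _) (abs_nonneg C)))
    simp only [mul_smul]
    rw [← Finset.smul_sum, norm_smul, Real.norm_of_nonneg (by positivity)]
    have h7 : s⁻¹ ≤ 2 := by
      rw [inv_le_comm₀ (by positivity) (by norm_num)]; linarith
    calc s⁻¹ * ‖∑ k ∈ Finset.Ico K L, a k • (realPart T ^ k) u‖ ≤ 2 * (|C| * ‖u‖) :=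
          mul_le_mul h7 (h5.trans h6) (norm_nonneg _) (by norm_num)
      _ = _ := by ring

theorem sum_range_glue {M : Type*} [AddCommMonoid M] {K L : ℕ} (hKL : K ≤ L) (g : ℕ → ℝ → M)
    (a b : ℕ → ℝ) :
    ∑ k ∈ Finset.range L, g k (if k < K then a k else if k < L then b k else 0) =
      ∑ k ∈ Finset.range K, g k (a k) + ∑ k ∈ Finset.Ico K L, g k (b k) := by
  rw [← Finset.sum_range_add_sum_Ico _ hKL]
  congr 1
  · refine Finset.sum_congr rfl fun k hk => ?_
    simp [Finset.mem_range.1 hk]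
  · refine Finset.sum_congr rfl fun k hk => ?_
    simp [(Finset.mem_Ico.1 hk).2, (Finset.mem_Ico.1 hk).1.not_gt]

/-- Each new window of mass one starts where the earlier ones end. The windows are therefore
disjoint, so no weight exceeds the mass one of its own window, while masses and norm bounds add up.
-/
theorem hasSpreadAverages (hr : spectralRadius ℂ T = 1) (hT : IsPositiveOperator T)
    (hWS : IsWSBounded.{u, v} T) : HasSpreadAverages (realPart T) := by
  obtain ⟨C, hC0, hC⟩ := exists_late_average hr hT hWS
  refine ⟨C, hC0, fun N => ?_⟩
  induction N with
  | zero => exact ⟨0, 0, by simp, by simp, by simp, by simp⟩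
  | succ N ih =>
    obtain ⟨K, a, ha0, ha1, haN, ha⟩ := ih
    obtain ⟨L, b, hb0, hb1, hb⟩ := hC K
    have hKL : K ≤ L := by
      by_contra h
      rw [Finset.Ico_eq_empty_of_le (not_le.1 h).le] at hb1
      simp at hb1
    set c : ℕ → ℝ := fun k => if k < K then a k else if k < L then b k else 0 with hc
    have split : ∀ g : ℕ → F, ∑ k ∈ Finset.range L, c k • g k =
        ∑ k ∈ Finset.range K, a k • g k + ∑ k ∈ Finset.Ico K L, b k • g k := fun g =>
      sum_range_glue hKL (fun k t => t • g k) a b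
    refine ⟨L, c, fun k => ?_, fun k => ?_, ?_, fun u hu => ?_⟩
    · simp only [hc]
      split_ifs
      exacts [ha0 k, hb0 k, le_rfl]
    · simp only [hc]
      split_ifs with h1 h2
      · exact ha1 k
      · rw [← hb1]
        exact Finset.single_le_sum (f := b) (fun k _ => hb0 k)
          (Finset.mem_Ico.2 ⟨not_lt.1 h1, h2⟩)
      · exact zero_le_one
    · rw [hc, sum_range_glue hKL (fun _ t => t) a b, haN, hb1]; push_cast; rfl
    · rw [split]
      refine (norm_add_le _ _).trans ((add_le_add (ha u hu) (hb u hu)).trans_eq ?_)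
      push_cast; ring

end RealPart

end LatticeComplexification

/-! ### Irreducibility in terms of hereditary cones -/

namespace LatticeComplexification

section Irreducible

open Filter Topology

variable {F : Type u} [NormedAddCommGroup F] [Lattice F] [HasSolidNorm F] [IsOrderedAddMonoid F]
  [NormedSpace ℝ F] [IsOrderedModule ℝ F] [CompleteSpace F]

theorem modulus_ofReal (x : F) : (ofReal x).modulus = |x| := by
  refine le_antisymm ?_ (abs_re_le_modulus (ofReal x))
  simpa using modulus_le_abs_add_abs (ofReal x)

theorem modulus_zero : (0 : LatticeComplexification F).modulus = 0 := by
  have : (0 : LatticeComplexification F) = ofReal 0 := rfl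
  rw [this, modulus_ofReal, abs_zero]

theorem modulus_eq_zero {z : LatticeComplexification F} (h : z.modulus = 0) : z = 0 :=
  norm_eq_zero.1 (by rw [norm_eq, h, norm_zero])

theorem modulus_smul_of_norm_one {c : ℂ} (hc : ‖c‖ = 1) (z : LatticeComplexification F) :
    (c • z).modulus = z.modulus := by
  refine le_antisymm (by simpa [hc] using modulus_smul_le c z) ?_
  have hc0 : c ≠ 0 := fun h => by simp [h] at hc
  have := modulus_smul_le c⁻¹ (c • z)
  rwa [smul_smul, inv_mul_cancel₀ hc0, one_smul, norm_inv, hc, inv_one, one_smul] at this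

theorem norm_modulus_sub_le (z w : LatticeComplexification F) :
    ‖z.modulus - w.modulus‖ ≤ ‖z - w‖ := by
  rw [norm_eq (z - w)]
  refine norm_le_norm_of_abs_le_abs ?_
  rw [abs_of_nonneg (modulus_nonneg _)]
  refine abs_le'.2 ⟨?_, ?_⟩
  · rw [sub_le_iff_le_add]
    simpa using modulus_add_le (z - w) w
  · rw [neg_sub, sub_le_iff_le_add]
    have := modulus_add_le (w - z) z
    rw [sub_add_cancel, ← neg_sub, modulus_neg] at this
    exact this

variable {T : LatticeComplexification F →L[ℂ] LatticeComplexification F}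

/-- A closed invariant hereditary cone of positive elements is trivial for an irreducible
operator. -/
theorem IsIrreducibleOperator.forall_of_exists (hT : IsPositiveOperator T)
    (hirr : IsIrreducibleOperator T) (p : F → Prop)
    (hadd : ∀ u w, 0 ≤ u → 0 ≤ w → p u → p w → p (u + w))
    (hmono : ∀ u w, 0 ≤ u → u ≤ w → p w → p u)
    (hinv : ∀ u, 0 ≤ u → p u → p (realPart T u))
    (hclosed : ∀ u, 0 ≤ u → (∀ ε > 0, ∃ w, 0 ≤ w ∧ p w ∧ ‖u - w‖ ≤ ε) → p u)
    {v : F} (hv : 0 ≤ v) (hv0 : v ≠ 0) (hpv : p v) (u : F) (hu : 0 ≤ u) : p u := by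
  have h0 : p 0 := hmono 0 v le_rfl hv hpv
  have hnat : ∀ (n : ℕ) (w : F), 0 ≤ w → p w → p ((n : ℝ) • w) := by
    intro n w hw hpw
    induction n with
    | zero => simpa using h0
    | succ n ih =>
      rw [Nat.cast_succ, add_smul, one_smul]
      exact hadd _ _ (smul_nonneg n.cast_nonneg hw) hw ih hpw
  -- The ideal consists of the elements whose modulus lies in the cone. For scalar multiples, `‖c‖`
  -- is dominated by a natural number, so additivity and heredity suffice.
  let I : Submodule ℂ (LatticeComplexification F) :=
    { carrier := {z | p z.modulus}
      add_mem' := fun {z w} hz hw => hmono _ _ (modulus_nonneg _) (modulus_add_le z w)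
        (hadd _ _ (modulus_nonneg _) (modulus_nonneg _) hz hw)
      zero_mem' := by simpa [modulus_zero] using h0
      smul_mem' := fun c z hz => by
        obtain ⟨n, hn⟩ := exists_nat_ge ‖c‖
        exact hmono _ _ (modulus_nonneg _) ((modulus_smul_le c z).trans
          (smul_le_smul_of_nonneg_right hn (modulus_nonneg z)))
          (hnat n _ (modulus_nonneg z) hz) }
  have hmem : ∀ z, z ∈ I ↔ p z.modulus := fun z => Iff.rfl
  have hIc : IsClosed (I : Set (LatticeComplexification F)) := by
    refine isClosed_of_closure_subset fun z hz => hclosed _ (modulus_nonneg z) fun ε hε => ?_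
    obtain ⟨w, hw, hzw⟩ := Metric.mem_closure_iff.1 hz ε hε
    refine ⟨w.modulus, modulus_nonneg w, hw, (norm_modulus_sub_le z w).trans ?_⟩
    rw [← dist_eq_norm]
    exact hzw.le
  rcases hirr I hIc (fun z hz w hwz => hmono _ _ (modulus_nonneg w) hwz hz) (fun z hz => by
    rw [hmem, apply_eq hT]
    exact hmono _ _ (modulus_nonneg _) (modulus_map_le (fun _ => realPart_nonneg hT) z)
      (hinv _ (modulus_nonneg z) hz)) with h | h
  · have : ofReal v ∈ I := by rwa [hmem, modulus_ofReal, abs_of_nonneg hv]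
    rw [h, Submodule.mem_bot] at this
    exact absurd (congrArg LatticeComplexification.re this) hv0
  · have : ofReal u ∈ I := h ▸ Submodule.mem_top
    rwa [hmem, modulus_ofReal, abs_of_nonneg hu] at this

end Irreducible

/-! ### Consequences of the averaging property for orbits -/

section Averages

open Filter Topology

variable {F : Type u} [NormedAddCommGroup F] [Lattice F] [HasSolidNorm F] [IsOrderedAddMonoid F]
  [NormedSpace ℝ F] [IsOrderedModule ℝ F] [CompleteSpace F] {R : F →L[ℝ] F}

/-- For `g = 1` this bounds the mass that weights in `[0, 1]` can place below `n`; for orbit norms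
it bounds the contribution of an initial segment. -/
theorem sum_range_ite_le (L n : ℕ) (g : ℕ → ℝ) (hg : ∀ k, 0 ≤ g k) :
    ∑ k ∈ Finset.range L, (if k < n then g k else 0) ≤ ∑ k ∈ Finset.range n, g k := by
  rw [← Finset.sum_filter]
  refine Finset.sum_le_sum_of_subset_of_nonneg (fun k hk => ?_) fun k _ _ => hg k
  exact Finset.mem_range.2 (Finset.mem_filter.1 hk).2

theorem le_pow_of_le_map (hR : ∀ u, 0 ≤ u → 0 ≤ R u) {x : F} (hx : x ≤ R x) {m n : ℕ}
    (hmn : m ≤ n) : (R ^ m) x ≤ (R ^ n) x := by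
  induction n, hmn using Nat.le_induction with
  | base => exact le_rfl
  | succ n _ ih =>
    refine ih.trans ?_
    rw [pow_succ, mul_apply_eq_comp]
    exact pow_mono_of_nonneg hR n hx

/-- Orbits of subfixed vectors are bounded. -/
theorem HasSpreadAverages.exists_bound (h : HasSpreadAverages R) (hR : ∀ u, 0 ≤ u → 0 ≤ R u)
    {x : F} (hx0 : 0 ≤ x) (hx : x ≤ R x) : ∃ B, ∀ n, ‖(R ^ n) x‖ ≤ B := by
  obtain ⟨C, hC0, hC⟩ := h
  refine ⟨2 * C * ‖x‖, fun n => ?_⟩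
  -- Of the mass `2 * (n + 1)` at most `n` sits below `n`, so at least `n + 1` sits where `R ^ k x ≥
  -- R ^ n x`. Subtracting one from the weights below `n` makes them nonpositive, so that this count
  -- becomes a termwise inequality.
  obtain ⟨L, a, ha0, ha1, haN, ha⟩ := hC (2 * (n + 1))
  have hcast : ((2 * (n + 1) : ℕ) : ℝ) = 2 * (n + 1) := by push_cast; rfl
  rw [hcast] at haN ha
  have hn0 : 0 ≤ (R ^ n) x := pow_nonneg_of_nonneg hR n hx0
  have h1 : ∀ k, (a k - if k < n then 1 else 0) • (R ^ n) x ≤ a k • (R ^ k) x := by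
    intro k
    split_ifs with hk
    · exact (smul_nonpos_of_nonpos_of_nonneg (by linarith [ha1 k]) hn0).trans
        (smul_nonneg (ha0 k) (pow_nonneg_of_nonneg hR k hx0))
    · rw [sub_zero]
      exact smul_le_smul_of_nonneg_left (le_pow_of_le_map hR hx (not_lt.1 hk)) (ha0 k)
  have h2 := Finset.sum_le_sum fun k (_ : k ∈ Finset.range L) => h1 k
  rw [← Finset.sum_smul, Finset.sum_sub_distrib, haN] at h2
  have h3 := sum_range_ite_le L n (fun _ => 1) fun _ => zero_le_one
  simp only [Finset.sum_const, Finset.card_range, nsmul_eq_mul, mul_one] at h3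
  have h4 : ((n : ℝ) + 1) • (R ^ n) x ≤ ∑ k ∈ Finset.range L, a k • (R ^ k) x :=
    (smul_le_smul_of_nonneg_right (by linarith) hn0).trans h2
  have h5 := (norm_le_norm_of_nonneg_of_le (smul_nonneg (by positivity) hn0) h4).trans (ha x hx0)
  rw [norm_smul, Real.norm_of_nonneg (by positivity)] at h5
  have h6 : (0 : ℝ) < n + 1 := by positivity
  refine le_of_mul_le_mul_left ?_ h6
  linarith

/-- Vectors whose orbits grow linearly do not exist. -/
theorem HasSpreadAverages.eq_zero_of_linear_growth (h : HasSpreadAverages R) {g x : F}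
    (hg : 0 ≤ g) (hx : 0 ≤ x) (hgrow : ∀ n : ℕ, (n : ℝ) • x ≤ (R ^ n) g + g) : x = 0 := by
  obtain ⟨C, hC0, hC⟩ := h
  have key : ∀ m : ℕ, (m : ℝ) * ‖x‖ ≤ 2 * (C + 1) * ‖g‖ := by
    intro m
    rcases Nat.eq_zero_or_pos m with rfl | hm
    · simpa using by positivity
    -- At least `m` of the mass `2 * m` sits at indices `k ≥ m`, where the growth is at least `m •
    -- x`. Hence `m ^ 2 * ‖x‖` is bounded by a multiple of `m * ‖g‖`.
    obtain ⟨L, a, ha0, ha1, haN, ha⟩ := hC (2 * m)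
    have hcast : ((2 * m : ℕ) : ℝ) = 2 * m := by push_cast; rfl
    rw [hcast] at haN ha
    have h1 : ∀ k, ((a k - if k < m then 1 else 0) * m) • x ≤ a k • (R ^ k) g + a k • g := by
      intro k
      rw [← smul_add]
      refine le_trans ?_ (smul_le_smul_of_nonneg_left (hgrow k) (ha0 k))
      rw [smul_smul]
      refine smul_le_smul_of_nonneg_right ?_ hx
      have hk0 : (0 : ℝ) ≤ k := k.cast_nonneg
      split_ifs with hk
      · have := mul_nonneg (ha0 k) hk0
        have : (a k - 1) * m ≤ 0 :=
          mul_nonpos_of_nonpos_of_nonneg (by linarith [ha1 k]) m.cast_nonneg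
        linarith
      · rw [sub_zero]
        exact mul_le_mul_of_nonneg_left (by exact_mod_cast not_lt.1 hk) (ha0 k)
    have h2 := Finset.sum_le_sum fun k (_ : k ∈ Finset.range L) => h1 k
    rw [← Finset.sum_smul, ← Finset.sum_mul, Finset.sum_sub_distrib, Finset.sum_add_distrib,
      ← Finset.sum_smul, haN] at h2
    have h3 := sum_range_ite_le L m (fun _ => 1) fun _ => zero_le_one
    simp only [Finset.sum_const, Finset.card_range, nsmul_eq_mul, mul_one] at h3
    have hm0 : (0 : ℝ) < m := by exact_mod_cast hm
    have h4 : ((m : ℝ) * m) • x ≤ ∑ k ∈ Finset.range L, a k • (R ^ k) g + (2 * (m : ℝ)) • g :=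
      (smul_le_smul_of_nonneg_right (mul_le_mul_of_nonneg_right (by linarith) hm0.le) hx).trans h2
    have h5 := (norm_le_norm_of_nonneg_of_le (smul_nonneg (by positivity) hx) h4).trans
      ((norm_add_le _ _).trans (add_le_add_left (ha g hg) _))
    rw [norm_smul, norm_smul, Real.norm_of_nonneg (by positivity),
      Real.norm_of_nonneg (by positivity)] at h5
    refine le_of_mul_le_mul_left ?_ hm0
    linarith
  by_contra hne
  have hpos : 0 < ‖x‖ := norm_pos_iff.2 hne
  obtain ⟨m, hm⟩ := exists_nat_gt (2 * (C + 1) * ‖g‖ / ‖x‖)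
  rw [div_lt_iff₀ hpos] at hm
  exact absurd (key m) (not_le.2 hm)

variable {T : LatticeComplexification F →L[ℂ] LatticeComplexification F}

/-- If the averages of some nonzero positive vector tend to zero, then there is no nonzero
subfixed vector. -/
theorem HasSpreadAverages.eq_zero_of_vanishing (hT : IsPositiveOperator T)
    (hirr : IsIrreducibleOperator T) {C : ℝ} {L : ℕ → ℕ} {a : ℕ → ℕ → ℝ}
    (hC0 : 0 ≤ C) (ha0 : ∀ N k, 0 ≤ a N k)
    (haN : ∀ N, ∑ k ∈ Finset.range (L N), a N k = N)
    (ha : ∀ N u, 0 ≤ u →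
      ‖∑ k ∈ Finset.range (L N), a N k • (realPart T ^ k) u‖ ≤ N * C * ‖u‖)
    {v : F} (hv : 0 ≤ v) (hv0 : v ≠ 0)
    (hpv : ∀ ε > 0, ∃ N₀ : ℕ, ∀ N : ℕ, N₀ ≤ N →
      ‖∑ k ∈ Finset.range (L N), a N k • (realPart T ^ k) v‖ ≤ ε * N)
    {x : F} (hx0 : 0 ≤ x) (hx : x ≤ realPart T x) : x = 0 := by
  have hR : ∀ u : F, 0 ≤ u → 0 ≤ realPart T u := fun _ => realPart_nonneg hT
  let A : ℕ → F →L[ℝ] F := fun N => ∑ k ∈ Finset.range (L N), a N k • realPart T ^ k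
  have hA : ∀ N u, A N u = ∑ k ∈ Finset.range (L N), a N k • (realPart T ^ k) u := fun N u => by
    simp [A]
  have hA0 : ∀ N u, 0 ≤ u → 0 ≤ A N u := fun N u hu => by
    rw [hA]
    exact Finset.sum_nonneg fun k _ => smul_nonneg (ha0 N k) (pow_nonneg_of_nonneg hR k hu)
  have hAmono : ∀ N u w, u ≤ w → A N u ≤ A N w := fun N u w h =>
    map_mono_of_nonneg (hA0 N) h
  have hcomm : ∀ N u, A N (realPart T u) = realPart T (A N u) := fun N u => by
    rw [hA, hA, map_sum]
    refine Finset.sum_congr rfl fun k _ => ?_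
    rw [map_smul, ← mul_apply_eq_comp, ← mul_apply_eq_comp, ← pow_succ, ← pow_succ']
  simp only [← hA] at ha hpv
  -- The cone in question is `‖A N u‖ = o(N)`. It is invariant because the averages commute with the
  -- operator, and closed because `A N / N` is bounded by `C` on the cone, uniformly in `N`.
  have hpx := hirr.forall_of_exists hT
    (fun u => ∀ ε > 0, ∃ N₀ : ℕ, ∀ N : ℕ, N₀ ≤ N → ‖A N u‖ ≤ ε * N)
    (fun u w _ _ hu hw ε hε => by
      obtain ⟨N₁, h1⟩ := hu (ε / 2) (half_pos hε)
      obtain ⟨N₂, h2⟩ := hw (ε / 2) (half_pos hε)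
      refine ⟨max N₁ N₂, fun N hN => ?_⟩
      rw [map_add]
      have h3 := h1 N ((le_max_left _ _).trans hN)
      have h4 := h2 N ((le_max_right _ _).trans hN)
      linarith [norm_add_le (A N u) (A N w)])
    (fun u w hu huw hw ε hε => by
      obtain ⟨N₁, h1⟩ := hw ε hε
      exact ⟨N₁, fun N hN => (norm_le_norm_of_nonneg_of_le (hA0 N u hu)
        (hAmono N u w huw)).trans (h1 N hN)⟩)
    (fun u hu hp ε hε => by
      have hn : 0 < ‖realPart T‖ + 1 := by positivity
      obtain ⟨N₁, h1⟩ := hp (ε / (‖realPart T‖ + 1)) (div_pos hε hn)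
      refine ⟨N₁, fun N hN => ?_⟩
      rw [hcomm]
      calc ‖realPart T (A N u)‖ ≤ ‖realPart T‖ * ‖A N u‖ := (realPart T).le_opNorm _
        _ ≤ (‖realPart T‖ + 1) * (ε / (‖realPart T‖ + 1) * N) :=
          mul_le_mul (by linarith) (h1 N hN) (norm_nonneg _) hn.le
        _ = ε * N := by field_simp)
    (fun u hu hp ε hε => by
      have hn : 0 < 2 * (C + 1) := by positivity
      obtain ⟨w, hw0, hw, huw⟩ := hp (ε / (2 * (C + 1))) (div_pos hε hn)
      obtain ⟨N₁, h1⟩ := hw (ε / 2) (half_pos hε)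
      refine ⟨N₁, fun N hN => ?_⟩
      have h2 : u ≤ |u - w| + w := by
        rw [← sub_le_iff_le_add]; exact le_abs_self _
      have h3 := norm_le_norm_of_nonneg_of_le (hA0 N u hu) (hAmono N _ _ h2)
      rw [map_add] at h3
      have h4 := ha N |u - w| (abs_nonneg _)
      rw [norm_abs_eq_norm] at h4
      have h5 : N * C * ‖u - w‖ ≤ ε / 2 * N := by
        calc N * C * ‖u - w‖ ≤ N * (C + 1) * (ε / (2 * (C + 1))) :=
              mul_le_mul (mul_le_mul_of_nonneg_left (by linarith) N.cast_nonneg) huw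
                (norm_nonneg _) (by positivity)
          _ = ε / 2 * N := by field_simp
      linarith [norm_add_le (A N |u - w|) (A N w), h1 N hN])
    hv hv0 hpv x hx0
  by_contra hne
  have hxn : 0 < ‖x‖ := norm_pos_iff.2 hne
  obtain ⟨N₀, hN⟩ := hpx (‖x‖ / 2) (half_pos hxn)
  have h1 := hN (N₀ + 1) (Nat.le_succ _)
  -- The orbit of `x` stays above `x` and the weights have mass `N`, so the averages of `x` cannot
  -- be `o(N)` unless `x = 0`.
  have h2 : ((N₀ + 1 : ℕ) : ℝ) • x ≤ A (N₀ + 1) x := by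
    rw [hA, ← haN (N₀ + 1), Finset.sum_smul]
    refine Finset.sum_le_sum fun k _ => smul_le_smul_of_nonneg_left ?_ (ha0 _ k)
    simpa using le_pow_of_le_map hR hx k.zero_le
  have h3 := norm_le_norm_of_nonneg_of_le (smul_nonneg (Nat.cast_nonneg _) hx0) h2
  rw [norm_smul, Real.norm_of_nonneg (Nat.cast_nonneg _)] at h3
  have h4 : (0 : ℝ) < ((N₀ + 1 : ℕ) : ℝ) := by positivity
  nlinarith

/-- A null orbit has averages of size `o(N)`: since weights are at most one, the first `M` terms
contribute at most a constant, and the later ones at most `ε / 2` times the mass `N`. A nonzero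
subfixed vector rules this out. -/
theorem HasSpreadAverages.not_tendsto_zero (h : HasSpreadAverages (realPart T))
    (hT : IsPositiveOperator T) (hirr : IsIrreducibleOperator T) {x : F} (hx0 : 0 ≤ x)
    (hx : x ≤ realPart T x) (hne : x ≠ 0) {u : F} (hu : 0 ≤ u) (hu0 : u ≠ 0) :
    ¬ Tendsto (fun k : ℕ => (realPart T ^ k) u) atTop (𝓝 0) := by
  intro hlim
  obtain ⟨C, hC0, hC⟩ := h
  choose L a ha0 ha1 haN ha using hC
  refine hne (HasSpreadAverages.eq_zero_of_vanishing hT hirr hC0 ha0 haN ha hu hu0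
    (fun ε hε => ?_) hx0 hx)
  obtain ⟨M, hM⟩ := eventually_atTop.1
    ((tendsto_zero_iff_norm_tendsto_zero.1 hlim).eventually (ge_mem_nhds (half_pos hε)))
  set B := ∑ k ∈ Finset.range M, ‖(realPart T ^ k) u‖ with hB
  obtain ⟨N₀, hN₀⟩ := exists_nat_ge (B / (ε / 2))
  refine ⟨N₀, fun N hN => ?_⟩
  have hBN : B ≤ ε / 2 * N := by
    have : (N₀ : ℝ) ≤ N := by exact_mod_cast hN
    have := hN₀.trans this
    rw [div_le_iff₀ (half_pos hε)] at this
    linarith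
  have h1 : ∀ k, ‖a N k • (realPart T ^ k) u‖ ≤
      (if k < M then ‖(realPart T ^ k) u‖ else 0) + a N k * (ε / 2) := by
    intro k
    rw [norm_smul, Real.norm_of_nonneg (ha0 N k)]
    split_ifs with hk
    · have h2 := mul_le_mul_of_nonneg_right (ha1 N k) (norm_nonneg ((realPart T ^ k) u))
      have h3 := mul_nonneg (ha0 N k) (half_pos hε).le
      linarith
    · rw [zero_add]
      exact mul_le_mul_of_nonneg_left (hM k (not_lt.1 hk)) (ha0 N k)
  have h2 := (norm_sum_le _ _).trans
    (Finset.sum_le_sum fun k (_ : k ∈ Finset.range (L N)) => h1 k)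
  rw [Finset.sum_add_distrib, ← Finset.sum_mul, haN] at h2
  have h3 := sum_range_ite_le (L N) M (fun k => ‖(realPart T ^ k) u‖) fun _ => norm_nonneg _
  linarith

/-- Positive subfixed vectors are fixed. -/
theorem HasSpreadAverages.map_eq_of_le_map (h : HasSpreadAverages (realPart T))
    (hT : IsPositiveOperator T) (hirr : IsIrreducibleOperator T) {x : F} (hx0 : 0 ≤ x)
    (hx : x ≤ realPart T x) : realPart T x = x := by
  have hR : ∀ u : F, 0 ≤ u → 0 ≤ realPart T u := fun _ => realPart_nonneg hT
  obtain ⟨B, hB⟩ := h.exists_bound hR hx0 hx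
  obtain ⟨C, hC0, hC⟩ := h
  choose L a ha0 ha1 haN ha using hC
  by_contra hne
  set y := realPart T x - x with hy
  have hy0 : 0 ≤ y := sub_nonneg.2 hx
  refine hne ?_
  have hx_zero := HasSpreadAverages.eq_zero_of_vanishing hT hirr hC0 ha0 haN ha hy0
    (sub_ne_zero.2 hne) (fun ε hε => ?_) hx0 hx
  · rw [hx_zero, map_zero]
  obtain ⟨N₀, hN₀⟩ := exists_nat_ge (B / ε)
  refine ⟨N₀, fun N hN => ?_⟩
  have hBN : B ≤ ε * N := by
    have : (N₀ : ℝ) ≤ N := by exact_mod_cast hN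
    have := hN₀.trans this
    rw [div_le_iff₀ hε] at this
    linarith
  -- The orbit of the defect `y` is positive, so the weights may be raised to one. The sum then
  -- telescopes and is bounded independently of `N` through the orbit of `x`.
  refine le_trans ?_ ((hB (L N)).trans hBN)
  have h0 : ∀ k, 0 ≤ (realPart T ^ k) y := fun k => pow_nonneg_of_nonneg hR k hy0
  refine norm_le_norm_of_nonneg_of_le
    (Finset.sum_nonneg fun k _ => smul_nonneg (ha0 N k) (h0 k)) ?_
  calc ∑ k ∈ Finset.range (L N), a N k • (realPart T ^ k) y
      ≤ ∑ k ∈ Finset.range (L N), ((realPart T ^ (k + 1)) x - (realPart T ^ k) x) := by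
        refine Finset.sum_le_sum fun k _ => ?_
        have : (realPart T ^ (k + 1)) x - (realPart T ^ k) x = (realPart T ^ k) y := by
          rw [hy, map_sub, pow_succ, mul_apply_eq_comp]
        rw [this]
        exact smul_le_of_le_one_left (h0 k) (ha1 N k)
    _ = (realPart T ^ L N) x - x := by
        rw [Finset.sum_range_sub fun k => (realPart T ^ k) x]; simp
    _ ≤ _ := sub_le_self _ hx0

end Averages

end LatticeComplexification

/-! ### The fixed space is a line spanned by a quasi-interior point -/

namespace LatticeComplexification

section FixedSpace

open Filter Topology

variable {F : Type u} [NormedAddCommGroup F] [Lattice F] [HasSolidNorm F] [IsOrderedAddMonoid F]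
  [NormedSpace ℝ F] [IsOrderedModule ℝ F] [CompleteSpace F]
  {T : LatticeComplexification F →L[ℂ] LatticeComplexification F}

/-- Truncations by a nonzero positive fixed vector converge. -/
theorem IsIrreducibleOperator.exists_norm_posPart_le (hT : IsPositiveOperator T)
    (hirr : IsIrreducibleOperator T) {x : F} (hx0 : 0 ≤ x) (hne : x ≠ 0)
    (hx : realPart T x = x) {u : F} (hu : 0 ≤ u) :
    ∀ ε > 0, ∃ n : ℕ, ‖(u - (n : ℝ) • x)⁺‖ ≤ ε := by
  have hR : ∀ u : F, 0 ≤ u → 0 ≤ realPart T u := fun _ => realPart_nonneg hT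
  -- Since `(u - n x)⁺ = u - u ⊓ n x`, the property says that the truncations of `u` by multiples of
  -- `x` approximate `u`. Its invariance rests on `x` being fixed, and `x` itself has it with `n =
  -- 1`.
  refine hirr.forall_of_exists hT (fun u => ∀ ε > 0, ∃ n : ℕ, ‖(u - (n : ℝ) • x)⁺‖ ≤ ε)
    ?_ ?_ ?_ ?_ hx0 hne ?_ u hu
  · intro u w _ _ hu hw ε hε
    obtain ⟨n, hn⟩ := hu (ε / 2) (half_pos hε)
    obtain ⟨m, hm⟩ := hw (ε / 2) (half_pos hε)
    refine ⟨n + m, ?_⟩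
    have h1 : (u + w - ((n + m : ℕ) : ℝ) • x)⁺ ≤ (u - (n : ℝ) • x)⁺ + (w - (m : ℝ) • x)⁺ := by
      rw [posPart_def, sup_le_iff]
      refine ⟨?_, add_nonneg (posPart_nonneg _) (posPart_nonneg _)⟩
      have : u + w - ((n + m : ℕ) : ℝ) • x = (u - (n : ℝ) • x) + (w - (m : ℝ) • x) := by
        push_cast; module
      rw [this]
      exact add_le_add (le_posPart _) (le_posPart _)
    have h2 := (norm_le_norm_of_nonneg_of_le (posPart_nonneg _) h1).trans (norm_add_le _ _)
    linarith
  · intro u w _ huw hw ε hε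
    obtain ⟨n, hn⟩ := hw ε hε
    exact ⟨n, (norm_le_norm_of_nonneg_of_le (posPart_nonneg _)
      (posPart_mono (sub_le_sub_right huw _))).trans hn⟩
  · intro u _ hu ε hε
    have hn : 0 < ‖realPart T‖ + 1 := by positivity
    obtain ⟨n, h1⟩ := hu (ε / (‖realPart T‖ + 1)) (div_pos hε hn)
    refine ⟨n, ?_⟩
    have h2 : (realPart T u - (n : ℝ) • x)⁺ ≤ realPart T (u - (n : ℝ) • x)⁺ := by
      rw [posPart_def, sup_le_iff]
      refine ⟨?_, hR _ (posPart_nonneg _)⟩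
      have := map_mono_of_nonneg hR (le_posPart (u - (n : ℝ) • x))
      rwa [map_sub, map_smul, hx] at this
    calc ‖(realPart T u - (n : ℝ) • x)⁺‖ ≤ ‖realPart T (u - (n : ℝ) • x)⁺‖ :=
          norm_le_norm_of_nonneg_of_le (posPart_nonneg _) h2
      _ ≤ ‖realPart T‖ * ‖(u - (n : ℝ) • x)⁺‖ := (realPart T).le_opNorm _
      _ ≤ (‖realPart T‖ + 1) * (ε / (‖realPart T‖ + 1)) :=
        mul_le_mul (by linarith) h1 (norm_nonneg _) hn.le
      _ = ε := by field_simp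
  · intro u hu h ε hε
    obtain ⟨w, hw0, hw, huw⟩ := h (ε / 2) (half_pos hε)
    obtain ⟨n, hn⟩ := hw (ε / 2) (half_pos hε)
    refine ⟨n, ?_⟩
    have h1 : (u - (n : ℝ) • x)⁺ ≤ |u - w| + (w - (n : ℝ) • x)⁺ := by
      rw [posPart_def, sup_le_iff]
      refine ⟨?_, add_nonneg (abs_nonneg _) (posPart_nonneg _)⟩
      have : u - (n : ℝ) • x = (u - w) + (w - (n : ℝ) • x) := by abel
      rw [this]
      exact add_le_add (le_abs_self _) (le_posPart _)
    have h2 := (norm_le_norm_of_nonneg_of_le (posPart_nonneg _) h1).trans (norm_add_le _ _)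
    rw [norm_abs_eq_norm] at h2
    linarith
  · intro ε hε
    refine ⟨1, ?_⟩
    simpa using hε.le

/-- Scaling the infimum by `1 / (n + 1)` brings it below both `a` and `b`; the shift avoids a
separate case `n = 0`. -/
theorem inf_smul_eq_zero {a b : F} (ha : 0 ≤ a) (hb : 0 ≤ b) (hab : a ⊓ b = 0) (n : ℕ) :
    a ⊓ ((n : ℝ) • b) ≤ 0 := by
  set d := a ⊓ ((n : ℝ) • b) with hd
  have hm : (0 : ℝ) < n + 1 := by positivity
  have h1 : ((n : ℝ) + 1)⁻¹ • d ≤ a ⊓ b := by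
    refine le_inf ?_ ?_
    · refine (smul_le_smul_of_nonneg_left (inf_le_left : d ≤ a) (by positivity)).trans ?_
      exact smul_le_of_le_one_left ha (inv_le_one_of_one_le₀ (by linarith [n.cast_nonneg (α := ℝ)]))
    · refine (smul_le_smul_of_nonneg_left (inf_le_right : d ≤ (n : ℝ) • b) (by positivity)).trans ?_
      rw [smul_smul]
      refine smul_le_of_le_one_left hb ?_
      rw [inv_mul_le_one₀ hm]
      linarith
  rw [hab] at h1
  have h2 := smul_le_smul_of_nonneg_left h1 hm.le
  rwa [smul_smul, mul_inv_cancel₀ hm.ne', one_smul, smul_zero] at h2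

/-- Real fixed vectors are comparable with zero. -/
theorem HasSpreadAverages.nonneg_or_nonpos (h : HasSpreadAverages (realPart T))
    (hT : IsPositiveOperator T) (hirr : IsIrreducibleOperator T) {u : F}
    (hu : realPart T u = u) : 0 ≤ u ∨ u ≤ 0 := by
  have hR : ∀ u : F, 0 ≤ u → 0 ≤ realPart T u := fun _ => realPart_nonneg hT
  -- The image of `u⁺` dominates both `0` and the image of `u`, which is `u`; so `u⁺` is subfixed,
  -- hence fixed.
  have hfix : realPart T u⁺ = u⁺ := by
    refine h.map_eq_of_le_map hT hirr (posPart_nonneg u) ?_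
    rw [posPart_def, sup_le_iff]
    refine ⟨?_, hR _ (posPart_nonneg u)⟩
    have := map_mono_of_nonneg hR (le_posPart u)
    rwa [hu] at this
  by_cases h0 : u⁺ = 0
  · exact Or.inr (posPart_eq_zero.1 h0)
  left
  rw [← negPart_eq_zero]
  -- The nonzero fixed vector `u⁺` truncates `u⁻` arbitrarily well, but `u⁻` is disjoint from all
  -- multiples of `u⁺`, so all truncations vanish.
  have key : ∀ ε > 0, ‖u⁻‖ ≤ ε := by
    intro ε hε
    obtain ⟨n, hn⟩ := hirr.exists_norm_posPart_le hT (posPart_nonneg u) h0 hfix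
      (negPart_nonneg u) ε hε
    refine (norm_le_norm_of_nonneg_of_le (negPart_nonneg u) ?_).trans hn
    have h1 := inf_smul_eq_zero (negPart_nonneg u) (posPart_nonneg u)
      (by rw [inf_comm]; exact posPart_inf_negPart_eq_zero u) n
    have h2 : u⁻ - (u⁻ - (n : ℝ) • u⁺)⁺ ≤ u⁻ ⊓ ((n : ℝ) • u⁺) := by
      refine le_inf (sub_le_self _ (posPart_nonneg _)) ?_
      rw [sub_le_comm]
      exact le_posPart _
    exact sub_nonpos.1 (h2.trans h1)
  exact norm_le_zero_iff.1 (le_of_forall_gt_imp_ge_of_dense key)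

theorem exists_smul_not_le {x : F} (hx0 : 0 ≤ x) (hne : x ≠ 0) (u : F) : ∃ t : ℝ, ¬ t • x ≤ u := by
  obtain ⟨n, hn⟩ := exists_nat_gt (‖u‖ / ‖x‖)
  refine ⟨n, fun h => ?_⟩
  rw [div_lt_iff₀ (norm_pos_iff.2 hne)] at hn
  have h1 := norm_le_norm_of_nonneg_of_le (smul_nonneg n.cast_nonneg hx0) h
  rw [norm_smul, Real.norm_of_nonneg n.cast_nonneg] at h1
  linarith

/-- The real fixed space is spanned by any of its nonzero positive elements. -/
theorem HasSpreadAverages.exists_eq_smul (h : HasSpreadAverages (realPart T))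
    (hT : IsPositiveOperator T) (hirr : IsIrreducibleOperator T) {x : F} (hx0 : 0 ≤ x)
    (hne : x ≠ 0) (hx : realPart T x = x) {u : F} (hu : realPart T u = u) :
    ∃ t : ℝ, u = t • x := by
  have hcmp : ∀ t : ℝ, t • x ≤ u ∨ u ≤ t • x := fun t => by
    have := h.nonneg_or_nonpos hT hirr (u := u - t • x) (by rw [map_sub, map_smul, hu, hx])
    rwa [sub_nonneg, sub_nonpos] at this
  have hcont : Continuous fun t : ℝ => t • x := continuous_id.smul continuous_const
  -- Every `u - t • x` is comparable with zero, so two nonempty closed sets of parameters cover the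
  -- line. By connectedness they meet, and equality holds at a common point.
  obtain ⟨t, -, ht⟩ := isPreconnected_closed_iff.1 isPreconnected_univ
    {t : ℝ | t • x ≤ u} {t : ℝ | u ≤ t • x} (isClosed_le hcont continuous_const)
    (isClosed_le continuous_const hcont) (fun t _ => hcmp t)
    (by
      obtain ⟨t, ht⟩ := exists_smul_not_le hx0 hne (-u)
      refine ⟨-t, trivial, (hcmp (-t)).resolve_right fun h => ht ?_⟩
      rw [neg_smul] at h
      exact le_neg_of_le_neg h)
    (by
      obtain ⟨t, ht⟩ := exists_smul_not_le hx0 hne u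
      exact ⟨t, trivial, (hcmp t).resolve_left ht⟩)
  exact ⟨t, le_antisymm ht.2 ht.1⟩

/-- A positive element all of whose truncations converge is a quasi-interior point. -/
theorem isQuasiInterior_ofReal {x : F} (hx0 : 0 ≤ x)
    (h : ∀ u, 0 ≤ u → ∀ ε > 0, ∃ n : ℕ, ‖(u - (n : ℝ) • x)⁺‖ ≤ ε) :
    IsQuasiInterior (ofReal x) := by
  have hpos : ∀ u : F, 0 ≤ u → ∀ ε > 0, ∃ (c : ℝ) (w : F), 0 ≤ c ∧ |w| ≤ c • x ∧ ‖u - w‖ ≤ ε := by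
    intro u hu ε hε
    obtain ⟨n, hn⟩ := h u hu ε hε
    -- This approximant is the truncation `u ⊓ n x`.
    refine ⟨n, u - (u - (n : ℝ) • x)⁺, n.cast_nonneg, ?_, by rwa [sub_sub_cancel]⟩
    rw [abs_of_nonneg, sub_le_comm]
    · exact le_posPart _
    · rw [sub_nonneg, posPart_def, sup_le_iff]
      exact ⟨sub_le_self _ (smul_nonneg n.cast_nonneg hx0), hu⟩
  have hreal : ∀ u : F, ∀ ε > 0, ∃ (c : ℝ) (w : F), 0 ≤ c ∧ |w| ≤ c • x ∧ ‖u - w‖ ≤ ε := by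
    intro u ε hε
    obtain ⟨c, w, hc, hw, huw⟩ := hpos u⁺ (posPart_nonneg u) (ε / 2) (half_pos hε)
    obtain ⟨d, v, hd, hv, huv⟩ := hpos u⁻ (negPart_nonneg u) (ε / 2) (half_pos hε)
    refine ⟨c + d, w - v, add_nonneg hc hd, ?_, ?_⟩
    · rw [add_smul]
      rw [sub_eq_add_neg]
      refine (abs_add_le w (-v)).trans ?_
      rw [abs_neg]
      exact add_le_add hw hv
    · have : u - (w - v) = (u⁺ - w) - (u⁻ - v) := by
        conv_lhs => rw [← posPart_sub_negPart u]
        abel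
      rw [this]
      linarith [norm_sub_le (u⁺ - w) (u⁻ - v)]
  refine ⟨nonneg_ofReal hx0, Metric.dense_iff.2 fun z ε hε => ?_⟩
  obtain ⟨c, w, hc, hw, huw⟩ := hreal z.re (ε / 3) (by positivity)
  obtain ⟨d, v, hd, hv, huv⟩ := hreal z.im (ε / 3) (by positivity)
  -- The summand `1` makes the constant strictly positive.
  refine ⟨⟨w, v⟩, ?_, c + d + 1, by positivity, ?_⟩
  · rw [Metric.mem_ball, dist_comm, dist_eq_norm]
    have := norm_le_add (z - ⟨w, v⟩)
    rw [sub_re, sub_im] at this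
    linarith
  · refine (modulus_le_abs_add_abs _).trans ((add_le_add hw hv).trans ?_)
    rw [← add_smul]
    exact smul_le_smul_of_nonneg_right (by linarith) hx0

end FixedSpace

end LatticeComplexification

/-! ### Lattice homomorphisms into the reals by a Hahn–Banach argument adapted to suprema -/

section LatticeCharacter

variable {G : Type u} [AddCommGroup G] [Lattice G] [IsOrderedAddMonoid G] [Module ℝ G]
  [IsOrderedModule ℝ G]

/-- A monotone sublinear functional that is compatible with finite suprema. -/
structure IsJoinSublinear (q : G → ℝ) : Prop where
  map_add_le : ∀ u w, q (u + w) ≤ q u + q w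
  map_smul_le : ∀ (s : ℝ) (u : G), 0 < s → q (s • u) ≤ s * q u
  mono : ∀ u w, u ≤ w → q u ≤ q w
  map_sup_le : ∀ u w, q (u ⊔ w) ≤ max (q u) (q w)

namespace IsJoinSublinear

variable {q : G → ℝ}

theorem map_zero (hq : IsJoinSublinear q) : q 0 = 0 := by
  have h1 := hq.map_smul_le 2 0 (by norm_num)
  have h2 := hq.map_smul_le (1 / 2) 0 (by norm_num)
  rw [smul_zero] at h1 h2
  linarith

theorem neg_le (hq : IsJoinSublinear q) (u : G) : -q (-u) ≤ q u := by
  have := hq.map_add_le u (-u)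
  rw [add_neg_cancel, hq.map_zero] at this
  linarith

theorem map_smul (hq : IsJoinSublinear q) {s : ℝ} (hs : 0 ≤ s) (u : G) : q (s • u) = s * q u := by
  rcases hs.eq_or_lt with rfl | hs
  · simp [hq.map_zero]
  refine le_antisymm (hq.map_smul_le s u hs) ?_
  have := hq.map_smul_le s⁻¹ (s • u) (inv_pos.2 hs)
  rw [smul_smul, inv_mul_cancel₀ hs.ne', one_smul] at this
  have h2 := mul_le_mul_of_nonneg_left this hs.le
  rwa [← mul_assoc, mul_inv_cancel₀ hs.ne', one_mul] at h2

/-- The largest functional below `q` that is linear in the direction of `v`. -/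
noncomputable def linearize (q : G → ℝ) (v w : G) : ℝ :=
  ⨅ t : Set.Ici (0 : ℝ), (q (w + (t : ℝ) • v) - t * q v)

theorem bddBelow_linearize (hq : IsJoinSublinear q) (v w : G) :
    BddBelow (Set.range fun t : Set.Ici (0 : ℝ) => q (w + (t : ℝ) • v) - t * q v) := by
  refine ⟨-q (-w), ?_⟩
  rintro _ ⟨t, rfl⟩
  have h1 := hq.map_add_le (w + (t : ℝ) • v) (-w)
  rw [add_neg_cancel_comm, hq.map_smul t.2] at h1
  dsimp only
  linarith

theorem linearize_le_of (hq : IsJoinSublinear q) (v w : G) {t : ℝ} (ht : 0 ≤ t) :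
    linearize q v w ≤ q (w + t • v) - t * q v :=
  ciInf_le (hq.bddBelow_linearize v w) ⟨t, ht⟩

theorem linearize_le (hq : IsJoinSublinear q) (v w : G) : linearize q v w ≤ q w := by
  simpa using hq.linearize_le_of v w le_rfl

theorem linearize_neg_le (hq : IsJoinSublinear q) (v : G) : linearize q v (-v) ≤ -q v := by
  simpa [hq.map_zero] using hq.linearize_le_of v (-v) zero_le_one

theorem exists_linearize_lt {v w : G} {r : ℝ} (h : linearize q v w < r) :
    ∃ t : ℝ, 0 ≤ t ∧ q (w + t • v) - t * q v < r := by
  obtain ⟨t, ht⟩ := exists_lt_of_ciInf_lt h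
  exact ⟨t, t.2, ht⟩

/-- Subadditivity along `v` makes the expressions under the infimum decrease in the parameter.
Near-minimizers for two vectors can thus be replaced by one common, larger parameter. -/
theorem antitone_aux (hq : IsJoinSublinear q) (v w : G) {s t : ℝ} (hst : s ≤ t) :
    q (w + t • v) - t * q v ≤ q (w + s • v) - s * q v := by
  have h1 := hq.map_add_le (w + s • v) ((t - s) • v)
  rw [hq.map_smul (sub_nonneg.2 hst)] at h1
  have : w + s • v + (t - s) • v = w + t • v := by module
  rw [this] at h1
  linarith

/-- Near-minimizers `s` and `t` combine to `s + t` for sums. For suprema both are moved to `max s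
t`, because translation by one vector commutes with `⊔`. -/
theorem isJoinSublinear_linearize (hq : IsJoinSublinear q) (v : G) :
    IsJoinSublinear (linearize q v) where
  map_add_le u w := by
    refine le_of_forall_pos_lt_add fun ε hε => ?_
    obtain ⟨s, hs0, hs⟩ := exists_linearize_lt
      (show linearize q v u < linearize q v u + ε / 2 by linarith)
    obtain ⟨t, ht0, ht⟩ := exists_linearize_lt
      (show linearize q v w < linearize q v w + ε / 2 by linarith)
    have h1 := hq.linearize_le_of v (u + w) (add_nonneg hs0 ht0)
    have h2 := hq.map_add_le (u + s • v) (w + t • v)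
    have : u + s • v + (w + t • v) = u + w + (s + t) • v := by module
    rw [this] at h2
    linarith
  map_smul_le c u hc := by
    refine le_of_forall_pos_lt_add fun ε hε => ?_
    obtain ⟨s, hs0, hs⟩ := exists_linearize_lt
      (show linearize q v u < linearize q v u + ε / c by linarith [div_pos hε hc])
    have h1 := hq.linearize_le_of v (c • u) (mul_nonneg hc.le hs0)
    have : c • u + (c * s) • v = c • (u + s • v) := by module
    rw [this, hq.map_smul hc.le] at h1
    have h2 := mul_lt_mul_of_pos_left hs hc
    rw [mul_add, mul_div_cancel₀ _ hc.ne'] at h2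
    linarith
  mono u w h := by
    refine le_ciInf fun t => (hq.linearize_le_of v u t.2).trans ?_
    exact sub_le_sub_right (hq.mono _ _ (by gcongr)) _
  map_sup_le u w := by
    refine le_of_forall_gt_imp_ge_of_dense fun r hr => ?_
    obtain ⟨s, hs0, hs⟩ := exists_linearize_lt ((le_max_left _ _).trans_lt hr)
    obtain ⟨t, ht0, ht⟩ := exists_linearize_lt ((le_max_right _ _).trans_lt hr)
    have h1 := hq.linearize_le_of v (u ⊔ w) (hs0.trans (le_max_left s t))
    have h2 := hq.antitone_aux v u (le_max_left s t)
    have h3 := hq.antitone_aux v w (le_max_right s t)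
    rw [sup_add] at h1
    have h4 := hq.map_sup_le (u + max s t • v) (w + max s t • v)
    rcases le_max_iff.1 h4 with h | h <;> linarith

/-- A minimal functional of this kind exists below every given one. -/
theorem exists_minimal (hq : IsJoinSublinear q) :
    ∃ m : G → ℝ, IsJoinSublinear m ∧ m ≤ q ∧ ∀ p, IsJoinSublinear p → p ≤ m → p = m := by
  let S : Set (G → ℝ) := {p | IsJoinSublinear p ∧ p ≤ q}
  have hlb : ∀ c ⊆ S, IsChain (· ≤ ·) c → ∀ y ∈ c, ∃ lb ∈ S, ∀ p ∈ c, lb ≤ p := by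
    intro c hc hchain y hy
    have : Nonempty c := ⟨⟨y, hy⟩⟩
    have hbdd : ∀ w, BddBelow (Set.range fun p : c => p.1 w) := fun w => by
      refine ⟨-q (-w), ?_⟩
      rintro _ ⟨p, rfl⟩
      have h1 := (hc p.2).1.neg_le w
      have h2 := (hc p.2).2 (-w)
      dsimp only
      linarith
    have hle : ∀ (p : c) (w : G), (⨅ p : c, p.1 w) ≤ p.1 w := fun p w => ciInf_le (hbdd w) p
    -- Any two members of the chain have one below both; this lets subadditivity and compatibility
    -- with suprema pass to the pointwise infimum.
    have hmin : ∀ p p' : c, ∃ r : c, r.1 ≤ p.1 ∧ r.1 ≤ p'.1 := fun p p' => by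
      rcases hchain.total p.2 p'.2 with h | h
      · exact ⟨p, le_rfl, h⟩
      · exact ⟨p', h, le_rfl⟩
    refine ⟨fun w => ⨅ p : c, p.1 w, ⟨⟨fun u w => ?_, fun s u hs => ?_, fun u w h => ?_,
      fun u w => ?_⟩, fun w => (hle ⟨y, hy⟩ w).trans ((hc hy).2 w)⟩, fun p hp w => hle ⟨p, hp⟩ w⟩
    · refine le_ciInf_add_ciInf fun p p' => ?_
      obtain ⟨r, hr, hr'⟩ := hmin p p'
      exact (hle r _).trans (((hc r.2).1.map_add_le u w).trans (add_le_add (hr u) (hr' w)))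
    · rw [Real.mul_iInf_of_nonneg hs.le]
      exact le_ciInf fun p => (hle p _).trans ((hc p.2).1.map_smul_le s u hs)
    · exact le_ciInf fun p => (hle p u).trans ((hc p.2).1.mono u w h)
    · refine le_of_forall_gt_imp_ge_of_dense fun r hr => ?_
      obtain ⟨p, hp⟩ := exists_lt_of_ciInf_lt ((le_max_left _ _).trans_lt hr)
      obtain ⟨p', hp'⟩ := exists_lt_of_ciInf_lt ((le_max_right _ _).trans_lt hr)
      obtain ⟨k, hk, hk'⟩ := hmin p p'
      refine (hle k _).trans (((hc k.2).1.map_sup_le u w).trans ?_)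
      exact max_le ((hk u).trans hp.le) ((hk' w).trans hp'.le)
  obtain ⟨m, hmq, hm⟩ : ∃ m, m ≤ q ∧ Minimal (· ∈ S) m :=
    @zorn_le_nonempty₀ (G → ℝ)ᵒᵈ _ S (fun c hc hchain => hlb c hc hchain.symm) q ⟨hq, le_rfl⟩
  exact ⟨m, hm.prop.1, hm.prop.2, fun p hp hpm =>
    le_antisymm hpm (hm.le_of_le ⟨hp, hpm.trans hm.prop.2⟩ hpm)⟩

end IsJoinSublinear

/-- A real lattice homomorphism with value `1` at `e`. -/
structure IsLatticeCharacter (e : G) (φ : G →ₗ[ℝ] ℝ) : Prop where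
  map_sup : ∀ u w, φ (u ⊔ w) = max (φ u) (φ w)
  map_unit : φ e = 1

/-- A minimal functional equals its own linearization in every direction, hence is odd, and an odd
sublinear functional is linear. Linearizing `q` along `v` before minimizing forces `-q v` as an
upper bound at `-v`, so the value at `v` is exactly `q v`. -/
theorem IsJoinSublinear.exists_linear {q : G → ℝ} (hq : IsJoinSublinear q) (v : G) :
    ∃ φ : G →ₗ[ℝ] ℝ, (∀ u w, φ (u ⊔ w) = max (φ u) (φ w)) ∧ (∀ u, φ u ≤ q u) ∧ φ v = q v := by
  obtain ⟨m, hm, hmq, hmin⟩ := (hq.isJoinSublinear_linearize v).exists_minimal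
  have hneg : ∀ u, m (-u) = -m u := fun u => by
    have h1 := hmin _ (hm.isJoinSublinear_linearize u) (hm.linearize_le u)
    have h2 := hm.linearize_neg_le u
    rw [h1] at h2
    linarith [hm.neg_le u]
  have hadd : ∀ u w, m (u + w) = m u + m w := fun u w => by
    refine le_antisymm (hm.map_add_le u w) ?_
    have := hm.map_add_le (u + w) (-w)
    rw [add_neg_cancel_right, hneg] at this
    linarith
  have hsmul : ∀ (c : ℝ) (u : G), m (c • u) = c * m u := fun c u => by
    rcases le_total 0 c with h | h
    · exact hm.map_smul h u
    · have h1 := hm.map_smul (neg_nonneg.2 h) u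
      rw [neg_smul, hneg] at h1
      linarith
  have hle : ∀ u, m u ≤ q u := fun u => (hmq u).trans (hq.linearize_le v u)
  refine ⟨{ toFun := m, map_add' := hadd, map_smul' := hsmul }, fun u w => ?_, hle, ?_⟩
  · exact le_antisymm (hm.map_sup_le u w)
      (max_le (hm.mono _ _ le_sup_left) (hm.mono _ _ le_sup_right))
  · refine le_antisymm (hle v) ?_
    have h1 := (hmq (-v)).trans (hq.linearize_neg_le v)
    rw [hneg] at h1
    change q v ≤ m v
    linarith

/-- The gauge of an order unit. -/
noncomputable def orderUnitGauge (e u : G) : ℝ := sInf {c : ℝ | u ≤ c • e}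

section OrderUnit

variable {e : G}

theorem bddBelow_orderUnitGauge (he0 : 0 ≤ e) (hne : e ≠ 0) (he : ∀ u : G, ∃ c : ℝ, u ≤ c • e)
    (u : G) : BddBelow {c : ℝ | u ≤ c • e} := by
  obtain ⟨d, hd⟩ := he (-u)
  refine ⟨-d, fun c hc => ?_⟩
  by_contra hlt
  have h1 : 0 ≤ (c + d) • e := by
    have := add_le_add hc hd
    rwa [add_neg_cancel, ← add_smul] at this
  have h2 : 0 < -(c + d) := by linarith
  have h3 : (-(c + d)) • e ≤ 0 := by rw [neg_smul]; exact neg_nonpos.2 h1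
  have h4 := smul_le_smul_of_nonneg_left h3 (inv_nonneg.2 h2.le)
  rw [smul_smul, inv_mul_cancel₀ h2.ne', one_smul, smul_zero] at h4
  exact hne (le_antisymm h4 he0)

/-- Compatibility with suprema holds because `u ⊔ w ≤ r • e` as soon as both `u` and `w` lie below
`r • e`. -/
theorem isJoinSublinear_orderUnitGauge (he0 : 0 ≤ e) (hne : e ≠ 0)
    (he : ∀ u : G, ∃ c : ℝ, u ≤ c • e) : IsJoinSublinear (orderUnitGauge e) := by
  have hbdd := bddBelow_orderUnitGauge he0 hne he
  have hle : ∀ {u : G} {c : ℝ}, u ≤ c • e → orderUnitGauge e u ≤ c := fun {u c} h =>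
    csInf_le (hbdd u) h
  have hlt : ∀ {u : G} {r : ℝ}, orderUnitGauge e u < r → u ≤ r • e := fun {u r} h => by
    obtain ⟨c, hc, hcr⟩ := exists_lt_of_csInf_lt (he u) h
    exact le_trans hc (smul_le_smul_of_nonneg_right hcr.le he0)
  refine ⟨fun u w => ?_, fun s u hs => ?_, fun u w h => ?_, fun u w => ?_⟩
  · refine le_of_forall_pos_le_add fun ε hε => hle ?_
    have h1 := hlt (show orderUnitGauge e u < orderUnitGauge e u + ε / 2 by linarith)
    have h2 := hlt (show orderUnitGauge e w < orderUnitGauge e w + ε / 2 by linarith)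
    refine (add_le_add h1 h2).trans_eq ?_
    rw [← add_smul]
    congr 1; ring
  · refine le_of_forall_pos_le_add fun ε hε => hle ?_
    have h1 := hlt (show orderUnitGauge e u < orderUnitGauge e u + ε / s by
      linarith [div_pos hε hs])
    refine (smul_le_smul_of_nonneg_left h1 hs.le).trans_eq ?_
    rw [smul_smul, mul_add, mul_div_cancel₀ _ hs.ne']
  · exact le_csInf (he w) fun c hc => hle (h.trans hc)
  · refine le_of_forall_gt_imp_ge_of_dense fun r hr => hle (sup_le ?_ ?_)
    · exact hlt ((le_max_left _ _).trans_lt hr)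
    · exact hlt ((le_max_right _ _).trans_lt hr)

/-- The lattice characters of an Archimedean vector lattice with order unit determine its order. -/
theorem nonpos_of_forall_isLatticeCharacter (he0 : 0 ≤ e) (hne : e ≠ 0)
    (he : ∀ u : G, ∃ c : ℝ, u ≤ c • e)
    (harch : ∀ u : G, (∀ ε : ℝ, 0 < ε → u ≤ ε • e) → u ≤ 0) {v : G}
    (h : ∀ φ : G →ₗ[ℝ] ℝ, IsLatticeCharacter e φ → φ v ≤ 0) : v ≤ 0 := by
  have hbdd := bddBelow_orderUnitGauge he0 hne he
  -- The functional attains the gauge at `v`, so `φ v ≤ 0` bounds the gauge itself. The gauge bounds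
  -- at `e` and `-e` force `φ e = 1`.
  obtain ⟨φ, hsup, hle, hv⟩ := (isJoinSublinear_orderUnitGauge he0 hne he).exists_linear v
  have h1 : φ e ≤ 1 := (hle e).trans (csInf_le (hbdd e) (by simp))
  have h2 : φ (-e) ≤ -1 := (hle (-e)).trans (csInf_le (hbdd (-e)) (by simp))
  rw [map_neg] at h2
  have h3 := h φ ⟨hsup, by linarith⟩
  rw [hv] at h3
  refine harch v fun ε hε => ?_
  obtain ⟨c, hc, hcr⟩ := exists_lt_of_csInf_lt (he v) (h3.trans_lt hε)
  exact le_trans hc (smul_le_smul_of_nonneg_right hcr.le he0)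

namespace IsLatticeCharacter

variable {φ : G →ₗ[ℝ] ℝ}

theorem mono (hφ : IsLatticeCharacter e φ) {u w : G} (h : u ≤ w) : φ u ≤ φ w := by
  rw [← sup_eq_right.2 h, hφ.map_sup]
  exact le_max_left _ _

end IsLatticeCharacter

end OrderUnit

end LatticeCharacter

/-! ### The principal order ideal as a function algebra on its characters -/

namespace LatticeComplexification

section OrderIdeal

open Filter Topology

variable {F : Type u} [NormedAddCommGroup F] [Lattice F] [HasSolidNorm F] [IsOrderedAddMonoid F]
  [NormedSpace ℝ F] [IsOrderedModule ℝ F] [CompleteSpace F]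

theorem abs_smul_le (a : ℝ) (u : F) : |a • u| ≤ |a| • |u| := by
  refine abs_le'.2 ⟨smul_le_abs_smul_abs a u, ?_⟩
  have := smul_le_abs_smul_abs (-a) u
  rwa [neg_smul, abs_neg] at this

/-- The order ideal of the real part generated by `x`. -/
def orderIdeal (x : F) : Submodule ℝ F where
  carrier := {u | ∃ c : ℝ, |u| ≤ c • x}
  zero_mem' := ⟨0, by simp⟩
  add_mem' := by
    rintro u w ⟨c, hc⟩ ⟨d, hd⟩
    refine ⟨c + d, (abs_add_le u w).trans ?_⟩
    rw [add_smul]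
    exact add_le_add hc hd
  smul_mem' := by
    rintro a u ⟨c, hc⟩
    refine ⟨|a| * c, (abs_smul_le a u).trans ?_⟩
    rw [mul_smul]
    exact smul_le_smul_of_nonneg_left hc (abs_nonneg a)

variable {x : F}

theorem mem_orderIdeal_of_abs_le {u w : F} (hw : w ∈ orderIdeal x) (h : |u| ≤ |w|) :
    u ∈ orderIdeal x := by
  obtain ⟨c, hc⟩ := hw
  exact ⟨c, h.trans hc⟩

theorem abs_mem_orderIdeal {u : F} (hu : u ∈ orderIdeal x) : |u| ∈ orderIdeal x :=
  mem_orderIdeal_of_abs_le hu (by rw [abs_abs])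

theorem abs_sup_le (u w : F) : |u ⊔ w| ≤ |u| + |w| := by
  refine abs_le'.2 ⟨sup_le ?_ ?_, ?_⟩
  · exact (le_abs_self u).trans (le_add_of_nonneg_right (abs_nonneg w))
  · exact (le_abs_self w).trans (le_add_of_nonneg_left (abs_nonneg u))
  · exact (neg_le_neg le_sup_left).trans
      ((neg_le_abs u).trans (le_add_of_nonneg_right (abs_nonneg w)))

theorem sup_mem_orderIdeal {u w : F} (hu : u ∈ orderIdeal x) (hw : w ∈ orderIdeal x) :
    u ⊔ w ∈ orderIdeal x := by
  refine mem_orderIdeal_of_abs_le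
    ((orderIdeal x).add_mem (abs_mem_orderIdeal hu) (abs_mem_orderIdeal hw)) ?_
  exact (abs_sup_le u w).trans (le_abs_self _)

theorem inf_mem_orderIdeal {u w : F} (hu : u ∈ orderIdeal x) (hw : w ∈ orderIdeal x) :
    u ⊓ w ∈ orderIdeal x := by
  have := (orderIdeal x).neg_mem
    (sup_mem_orderIdeal ((orderIdeal x).neg_mem hu) ((orderIdeal x).neg_mem hw))
  rwa [neg_sup, neg_neg, neg_neg] at this

noncomputable instance : Lattice (orderIdeal x) :=
  { (inferInstance : PartialOrder (orderIdeal x)) with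
    sup := fun u w => ⟨u.1 ⊔ w.1, sup_mem_orderIdeal u.2 w.2⟩
    inf := fun u w => ⟨u.1 ⊓ w.1, inf_mem_orderIdeal u.2 w.2⟩
    le_sup_left := fun u w => (le_sup_left : u.1 ≤ u.1 ⊔ w.1)
    le_sup_right := fun u w => (le_sup_right : w.1 ≤ u.1 ⊔ w.1)
    sup_le := fun u w v h h' => (sup_le h h' : u.1 ⊔ w.1 ≤ v.1)
    inf_le_left := fun u w => (inf_le_left : u.1 ⊓ w.1 ≤ u.1)
    inf_le_right := fun u w => (inf_le_right : u.1 ⊓ w.1 ≤ w.1)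
    le_inf := fun u w v h h' => (le_inf h h' : u.1 ≤ w.1 ⊓ v.1) }

instance : IsOrderedAddMonoid (orderIdeal x) where
  add_le_add_left u w h v := (add_le_add_left (show u.1 ≤ w.1 from h) v.1 : _)

instance : IsOrderedModule ℝ (orderIdeal x) where
  smul_le_smul_of_nonneg_left a ha u w h :=
    (smul_le_smul_of_nonneg_left (show u.1 ≤ w.1 from h) ha : a • u.1 ≤ a • w.1)
  smul_le_smul_of_nonneg_right u hu a b h :=
    (smul_le_smul_of_nonneg_right h (show 0 ≤ u.1 from hu) : a • u.1 ≤ b • u.1)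

/-- The generator as an element of the order ideal. -/
def orderIdealUnit (hx : 0 ≤ x) : orderIdeal x := ⟨x, 1, by rw [one_smul, abs_of_nonneg hx]⟩

theorem exists_abs_le_smul (hx : 0 ≤ x) (u : orderIdeal x) :
    ∃ c : ℝ, 0 ≤ c ∧ |u.1| ≤ c • x := by
  obtain ⟨c, hc⟩ := u.2
  exact ⟨|c|, abs_nonneg c, hc.trans (smul_le_smul_of_nonneg_right (le_abs_self c) hx)⟩

theorem exists_le_smul_unit (hx : 0 ≤ x) (u : orderIdeal x) :
    ∃ c : ℝ, u ≤ c • orderIdealUnit hx := by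
  obtain ⟨c, -, hc⟩ := exists_abs_le_smul hx u
  exact ⟨c, ((le_abs_self u.1).trans hc : u.1 ≤ c • x)⟩

/-- The positive cone is norm closed; this is the Archimedean property needed for the principal
ideal. -/
theorem le_of_forall_le_add_smul {u w x : F} (h : ∀ ε : ℝ, 0 < ε → u ≤ w + ε • x) : u ≤ w := by
  have h1 : Tendsto (fun n : ℕ => w + (1 / ((n : ℝ) + 1)) • x) atTop (𝓝 (w + (0 : ℝ) • x)) :=
    (tendsto_one_div_add_atTop_nhds_zero_nat.smul_const x).const_add w
  rw [zero_smul, add_zero] at h1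
  exact ge_of_tendsto' h1 fun n => h _ (by positivity)

/-- This takes the place of Kakutani's representation theorem: inequalities in the ideal may be
checked pointwise, with characters as points. -/
theorem le_of_forall_character (hx : 0 ≤ x) (hne : x ≠ 0) {u w : orderIdeal x}
    (h : ∀ φ : orderIdeal x →ₗ[ℝ] ℝ, IsLatticeCharacter (orderIdealUnit hx) φ → φ u ≤ φ w) :
    u ≤ w := by
  rw [← sub_nonpos]
  refine nonpos_of_forall_isLatticeCharacter (e := orderIdealUnit hx) hx
    (fun h => hne (congrArg Subtype.val h)) (exists_le_smul_unit hx) (fun v hv => ?_)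
    fun φ hφ => ?_
  · refine (le_of_forall_le_add_smul (x := x) fun ε hε => ?_ : v.1 ≤ 0)
    rw [zero_add]
    exact hv ε hε
  · rw [map_sub, sub_nonpos]
    exact h φ hφ

theorem abs_character_le (hx : 0 ≤ x) {φ : orderIdeal x →ₗ[ℝ] ℝ}
    (hφ : IsLatticeCharacter (orderIdealUnit hx) φ) {u : orderIdeal x} {c : ℝ}
    (hc : |u.1| ≤ c • x) : |φ u| ≤ c := by
  have h1 : ∀ w : orderIdeal x, w.1 ≤ c • x → φ w ≤ c := fun w hw => by
    have := hφ.mono (show w ≤ c • orderIdealUnit hx from hw)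
    rwa [map_smul, hφ.map_unit, smul_eq_mul, mul_one] at this
  refine abs_le'.2 ⟨h1 u ((le_abs_self _).trans hc), ?_⟩
  rw [← map_neg]
  exact h1 (-u) ((neg_le_abs _).trans hc)

theorem abs_le_of_forall_character (hx : 0 ≤ x) (hne : x ≠ 0) {u : orderIdeal x} {c : ℝ}
    (h : ∀ φ : orderIdeal x →ₗ[ℝ] ℝ, IsLatticeCharacter (orderIdealUnit hx) φ → |φ u| ≤ c) :
    |u.1| ≤ c • x := by
  refine abs_le'.2 ⟨?_, ?_⟩
  · refine le_of_forall_character hx hne (w := c • orderIdealUnit hx) fun φ hφ => ?_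
    rw [map_smul, hφ.map_unit, smul_eq_mul, mul_one]
    exact (abs_le'.1 (h φ hφ)).1
  · refine le_of_forall_character hx hne (u := -u) (w := c • orderIdealUnit hx) fun φ hφ => ?_
    rw [map_smul, hφ.map_unit, smul_eq_mul, mul_one, map_neg]
    exact (abs_le'.1 (h φ hφ)).2

/-- Functions of the characters that are uniform limits of elements are elements. -/
theorem exists_of_forall_approx (hx : 0 ≤ x) (hne : x ≠ 0) (h : (orderIdeal x →ₗ[ℝ] ℝ) → ℝ)
    (happ : ∀ ε > 0, ∃ u : orderIdeal x, ∀ φ : orderIdeal x →ₗ[ℝ] ℝ,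
      IsLatticeCharacter (orderIdealUnit hx) φ → |φ u - h φ| ≤ ε) :
    ∃ u : orderIdeal x, ∀ φ : orderIdeal x →ₗ[ℝ] ℝ,
      IsLatticeCharacter (orderIdealUnit hx) φ → φ u = h φ := by
  have hδ : ∀ n : ℕ, (0 : ℝ) < 1 / ((n : ℝ) + 1) := fun n => by positivity
  choose s hs using fun n : ℕ => happ _ (hδ n)
  have hlim : Tendsto (fun n : ℕ => 1 / ((n : ℝ) + 1)) atTop (𝓝 0) :=
    tendsto_one_div_add_atTop_nhds_zero_nat
  have hdist : ∀ m n : ℕ,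
      |(s m).1 - (s n).1| ≤ (1 / ((m : ℝ) + 1) + 1 / ((n : ℝ) + 1)) • x := by
    intro m n
    refine abs_le_of_forall_character hx hne (u := s m - s n) fun φ hφ => ?_
    have h1 := hs m φ hφ
    have h2 := hs n φ hφ
    rw [map_sub]
    have h3 : φ (s m) - φ (s n) = (φ (s m) - h φ) - (φ (s n) - h φ) := by ring
    rw [h3]
    exact (abs_sub _ _).trans (add_le_add h1 h2)
  have hcau : CauchySeq fun n => (s n).1 := by
    rw [cauchySeq_iff_tendsto_dist_atTop_0]
    have h1 : Tendsto (fun p : ℕ × ℕ => (1 / ((p.1 : ℝ) + 1) + 1 / ((p.2 : ℝ) + 1)) * ‖x‖)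
        atTop (𝓝 0) := by
      rw [← prod_atTop_atTop_eq]
      have := ((hlim.comp tendsto_fst).add (hlim.comp tendsto_snd) :
        Tendsto _ (atTop ×ˢ atTop : Filter (ℕ × ℕ)) _).mul_const ‖x‖
      simpa using this
    refine squeeze_zero (fun _ => dist_nonneg) (fun p => ?_) h1
    have h2 := norm_le_norm_of_nonneg_of_le (abs_nonneg _) (hdist p.1 p.2)
    rwa [norm_abs_eq_norm, norm_smul, Real.norm_of_nonneg (by positivity), ← dist_eq_norm] at h2
  obtain ⟨u, hu⟩ := cauchySeq_tendsto_of_complete hcau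
  -- Characters are controlled by order bounds in terms of `x`, so the order estimate between the `s
  -- n` is passed to the norm limit.
  have hsu : ∀ n : ℕ, |(s n).1 - u| ≤ (1 / ((n : ℝ) + 1)) • x := by
    intro n
    have h1 : Tendsto (fun m : ℕ => (1 / ((n : ℝ) + 1) + 1 / ((m : ℝ) + 1)) • x) atTop
        (𝓝 ((1 / ((n : ℝ) + 1) + 0) • x)) := (hlim.const_add _).smul_const x
    rw [add_zero] at h1
    have h2 : Tendsto (fun m : ℕ => (s n).1 - (s m).1) atTop (𝓝 ((s n).1 - u)) :=
      hu.const_sub _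
    refine abs_le'.2 ⟨le_of_tendsto_of_tendsto' h2 h1 fun m => (le_abs_self _).trans (hdist n m),
      le_of_tendsto_of_tendsto' h2.neg h1 fun m => (neg_le_abs _).trans (hdist n m)⟩
  have hmem : u ∈ orderIdeal x := by
    have h1 : (s 0).1 - u ∈ orderIdeal x := ⟨_, hsu 0⟩
    have h2 := (orderIdeal x).sub_mem (s 0).2 h1
    rwa [sub_sub_cancel] at h2
  refine ⟨⟨u, hmem⟩, fun φ hφ => ?_⟩
  have h3 : ∀ n : ℕ, |φ ⟨u, hmem⟩ - h φ| ≤ 1 / ((n : ℝ) + 1) + 1 / ((n : ℝ) + 1) := by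
    intro n
    have h4 := abs_character_le hx hφ (u := s n - ⟨u, hmem⟩) (hsu n)
    rw [map_sub, abs_sub_comm] at h4
    have h5 : φ ⟨u, hmem⟩ - h φ = (φ ⟨u, hmem⟩ - φ (s n)) + (φ (s n) - h φ) := by ring
    rw [h5]
    exact (abs_add_le _ _).trans (add_le_add h4 (hs n φ hφ))
  have h6 := ge_of_tendsto' (hlim.add hlim) h3
  rw [add_zero] at h6
  exact sub_eq_zero.1 (abs_nonpos_iff.1 h6)

/-- Squares exist in the order ideal, as suprema of tangents. -/
theorem exists_sq (hx : 0 ≤ x) (hne : x ≠ 0) (f : orderIdeal x) :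
    ∃ g : orderIdeal x, ∀ φ : orderIdeal x →ₗ[ℝ] ℝ,
      IsLatticeCharacter (orderIdealUnit hx) φ → φ g = φ f ^ 2 := by
  refine exists_of_forall_approx hx hne (fun φ => φ f ^ 2) fun ε hε => ?_
  obtain ⟨c, hc0, hc⟩ := exists_abs_le_smul hx f
  set δ := √ε with hδ
  have hδ0 : 0 < δ := Real.sqrt_pos.2 hε
  -- The element `u` is the supremum of `0` and the tangents `2 t f - t ^ 2`, which equal `f ^ 2 -
  -- (f - t) ^ 2` pointwise, for `t` in a grid of width `δ` starting at `-c`. It lies below `f ^ 2`,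
  -- and the grid point just below the value of `f` gives an error of at most `δ ^ 2 = ε`.
  have key : ∀ m : ℕ, ∃ u : orderIdeal x, ∀ φ : orderIdeal x →ₗ[ℝ] ℝ,
      IsLatticeCharacter (orderIdealUnit hx) φ → φ u ≤ φ f ^ 2 ∧
        ∀ k : ℕ, k < m → φ f ^ 2 - (φ f - (-c + k * δ)) ^ 2 ≤ φ u := by
    intro m
    induction m with
    | zero => exact ⟨0, fun φ _ => ⟨by rw [map_zero]; positivity, fun k hk => absurd hk (by simp)⟩⟩
    | succ m ih =>
      obtain ⟨u, hu⟩ := ih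
      set t := -c + m * δ with ht
      refine ⟨u ⊔ ((2 * t) • f - (t ^ 2) • orderIdealUnit hx), fun φ hφ => ?_⟩
      have h1 : φ ((2 * t) • f - (t ^ 2) • orderIdealUnit hx) = φ f ^ 2 - (φ f - t) ^ 2 := by
        rw [map_sub, map_smul, map_smul, hφ.map_unit, smul_eq_mul, smul_eq_mul]
        ring
      rw [hφ.map_sup, h1]
      refine ⟨max_le (hu φ hφ).1 (sub_le_self _ (sq_nonneg _)), fun k hk => ?_⟩
      rcases Nat.lt_succ_iff_lt_or_eq.1 hk with h | rfl
      · exact ((hu φ hφ).2 k h).trans (le_max_left _ _)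
      · exact le_max_right _ _
  obtain ⟨m, hm⟩ := exists_nat_gt (2 * c / δ)
  obtain ⟨u, hu⟩ := key m
  refine ⟨u, fun φ hφ => ?_⟩
  have ha := abs_le.1 (abs_character_le hx hφ hc)
  have hb0 : 0 ≤ (φ f + c) / δ := div_nonneg (by linarith) hδ0.le
  have hk1 := Nat.floor_le hb0
  have hk2 := Nat.lt_floor_add_one ((φ f + c) / δ)
  set k := ⌊(φ f + c) / δ⌋₊ with hk
  rw [le_div_iff₀ hδ0] at hk1
  rw [div_lt_iff₀ hδ0] at hk2
  have hkm : k < m := by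
    have h1 : (φ f + c) / δ ≤ 2 * c / δ := by gcongr; linarith
    have h2 : (k : ℝ) ≤ (φ f + c) / δ := Nat.floor_le hb0
    exact_mod_cast (h2.trans h1).trans_lt hm
  have h1 := (hu φ hφ).2 k hkm
  have h2 : (φ f - (-c + k * δ)) ^ 2 ≤ ε := by
    rw [← Real.sq_sqrt hε.le, ← hδ]
    exact pow_le_pow_left₀ (by linarith) (by linarith) 2
  rw [abs_le]
  constructor <;> linarith [(hu φ hφ).1]

/-- Polarization recovers products from squares. -/
theorem exists_mul (hx : 0 ≤ x) (hne : x ≠ 0) (f g : orderIdeal x) :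
    ∃ h : orderIdeal x, ∀ φ : orderIdeal x →ₗ[ℝ] ℝ,
      IsLatticeCharacter (orderIdealUnit hx) φ → φ h = φ f * φ g := by
  obtain ⟨a, ha⟩ := exists_sq hx hne (f + g)
  obtain ⟨b, hb⟩ := exists_sq hx hne (f - g)
  refine ⟨(1 / 4 : ℝ) • (a - b), fun φ hφ => ?_⟩
  rw [map_smul, map_sub, ha φ hφ, hb φ hφ, map_add, map_sub, smul_eq_mul]
  ring

end OrderIdeal

end LatticeComplexification

/-! ### Multiplication in the complexified ideal -/

namespace LatticeComplexification

section ComplexIdeal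

variable {F : Type u} [NormedAddCommGroup F] [Lattice F] [HasSolidNorm F] [IsOrderedAddMonoid F]
  [NormedSpace ℝ F] [IsOrderedModule ℝ F] [CompleteSpace F]

/-- The complexification of the order ideal generated by `x`. -/
def complexIdeal (x : F) : Submodule ℂ (LatticeComplexification F) where
  carrier := {z | z.re ∈ orderIdeal x ∧ z.im ∈ orderIdeal x}
  zero_mem' := ⟨zero_mem _, zero_mem _⟩
  add_mem' := fun hz hw => ⟨add_mem hz.1 hw.1, add_mem hz.2 hw.2⟩
  smul_mem' := fun c _ hz =>
    ⟨sub_mem (Submodule.smul_mem _ c.re hz.1) (Submodule.smul_mem _ c.im hz.2),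
      add_mem (Submodule.smul_mem _ c.re hz.2) (Submodule.smul_mem _ c.im hz.1)⟩

variable {x : F}

theorem mem_complexIdeal_of_modulus_le {z : LatticeComplexification F} {c : ℝ}
    (h : z.modulus ≤ c • x) : z ∈ complexIdeal x :=
  ⟨⟨c, (abs_re_le_modulus z).trans h⟩, ⟨c, (abs_im_le_modulus z).trans h⟩⟩

/-- The real part of an element of the complexified ideal. -/
def idealRe (z : complexIdeal x) : orderIdeal x := ⟨z.1.re, z.2.1⟩

/-- The imaginary part of an element of the complexified ideal. -/
def idealIm (z : complexIdeal x) : orderIdeal x := ⟨z.1.im, z.2.2⟩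

/-- The modulus of an element of the complexified ideal. -/
noncomputable def idealModulus (z : complexIdeal x) : orderIdeal x :=
  ⟨z.1.modulus, mem_orderIdeal_of_abs_le
    (add_mem (abs_mem_orderIdeal z.2.1) (abs_mem_orderIdeal z.2.2)) (by
      rw [abs_of_nonneg (modulus_nonneg _)]
      exact (modulus_le_abs_add_abs z.1).trans (le_abs_self _))⟩

/-- The complex-linear extension of a functional on the order ideal. -/
noncomputable def complexify (ψ : orderIdeal x →ₗ[ℝ] ℝ) : complexIdeal x →ₗ[ℂ] ℂ where
  toFun z := ⟨ψ (idealRe z), ψ (idealIm z)⟩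
  map_add' z w := Complex.ext (ψ.map_add (idealRe z) (idealRe w))
    (ψ.map_add (idealIm z) (idealIm w))
  map_smul' c z := by
    have h1 : idealRe (c • z) = c.re • idealRe z - c.im • idealIm z := rfl
    have h2 : idealIm (c • z) = c.re • idealIm z + c.im • idealRe z := rfl
    apply Complex.ext
    · simp [h1]
    · simp [h2]

theorem complexify_re (ψ : orderIdeal x →ₗ[ℝ] ℝ) (z : complexIdeal x) :
    (complexify ψ z).re = ψ (idealRe z) := rfl

theorem complexify_im (ψ : orderIdeal x →ₗ[ℝ] ℝ) (z : complexIdeal x) :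
    (complexify ψ z).im = ψ (idealIm z) := rfl

theorem re_mul_complexify (ψ : orderIdeal x →ₗ[ℝ] ℝ) (α : ℂ) (z : complexIdeal x) :
    ψ (α.re • idealRe z + α.im • idealIm z) =
      α.re * (complexify ψ z).re + α.im * (complexify ψ z).im := by
  rw [map_add, map_smul, map_smul]
  rfl

/-- The modulus of the value is `ψ` of the rotation by its argument, and rotations lie below the
modulus. Only monotonicity enters, so this also serves for compositions of a character with the
operator. -/
theorem norm_complexify_le {ψ : orderIdeal x →ₗ[ℝ] ℝ} (hψ : ∀ u w, u ≤ w → ψ u ≤ ψ w)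
    (z : complexIdeal x) : ‖complexify ψ z‖ ≤ ψ (idealModulus z) := by
  set α := complexify ψ z with hα
  have h1 : ψ (Real.cos α.arg • idealRe z + Real.sin α.arg • idealIm z) = ‖α‖ := by
    rw [map_add, map_smul, map_smul, ← complexify_re, ← complexify_im, ← hα, smul_eq_mul,
      smul_eq_mul, ← Complex.norm_mul_cos_arg α, ← Complex.norm_mul_sin_arg α]
    linear_combination ‖α‖ * Real.cos_sq_add_sin_sq α.arg
  rw [← h1]
  exact hψ _ _ (rot_le_modulus z.1 α.arg)

/-- The modulus is a supremum of infinitely many rotations, which a character need not respect.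
Instead it is dominated by `(t + t⁻¹ (re² + im²)) / 2`, an element of the ideal lying above all
rotations by the arithmetic–geometric mean inequality. Taking `t` just above the pointwise modulus
gives the bound; the added `ε` covers modulus zero. -/
theorem norm_complexify (hx : 0 ≤ x) (hne : x ≠ 0) {φ : orderIdeal x →ₗ[ℝ] ℝ}
    (hφ : IsLatticeCharacter (orderIdealUnit hx) φ) (z : complexIdeal x) :
    ‖complexify φ z‖ = φ (idealModulus z) := by
  refine le_antisymm (norm_complexify_le (fun _ _ => hφ.mono) z) ?_
  obtain ⟨a, ha⟩ := exists_sq hx hne (idealRe z)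
  obtain ⟨b, hb⟩ := exists_sq hx hne (idealIm z)
  have hsq : ∀ χ : orderIdeal x →ₗ[ℝ] ℝ, IsLatticeCharacter (orderIdealUnit hx) χ →
      χ a + χ b = ‖complexify χ z‖ ^ 2 := fun χ hχ => by
    rw [ha χ hχ, hb χ hχ, Complex.sq_norm, Complex.normSq_apply, complexify_re, complexify_im]
    ring
  have key : ∀ t : ℝ, 0 < t → φ (idealModulus z) ≤ (t + t⁻¹ * ‖complexify φ z‖ ^ 2) / 2 := by
    intro t ht
    let s : orderIdeal x := (1 / 2 : ℝ) • (t • orderIdealUnit hx + t⁻¹ • (a + b))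
    have hs : ∀ χ : orderIdeal x →ₗ[ℝ] ℝ, IsLatticeCharacter (orderIdealUnit hx) χ →
        χ s = (t + t⁻¹ * ‖complexify χ z‖ ^ 2) / 2 := fun χ hχ => by
      rw [map_smul, map_add, map_smul, map_smul, hχ.map_unit, map_add, hsq χ hχ, smul_eq_mul,
        smul_eq_mul, smul_eq_mul]
      ring
    rw [← hs φ hφ]
    refine hφ.mono (modulus_le fun θ => ?_ : z.1.modulus ≤ s.1)
    refine le_of_forall_character hx hne
      (u := Real.cos θ • idealRe z + Real.sin θ • idealIm z) fun χ hχ => ?_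
    rw [hs χ hχ]
    set r := ‖complexify χ z‖ with hr
    have h1 : χ (Real.cos θ • idealRe z + Real.sin θ • idealIm z) ≤ r := by
      rw [map_add, map_smul, map_smul, ← complexify_re, ← complexify_im, smul_eq_mul, smul_eq_mul]
      have h2 : (Complex.exp (-θ * Complex.I) * complexify χ z).re ≤ r := by
        refine (Complex.re_le_norm _).trans ?_
        rw [norm_mul, ← Complex.ofReal_neg, Complex.norm_exp_ofReal_mul_I, one_mul]
      rw [Complex.mul_re, ← Complex.ofReal_neg, Complex.exp_ofReal_mul_I_re,
        Complex.exp_ofReal_mul_I_im, Real.cos_neg, Real.sin_neg] at h2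
      linarith
    refine h1.trans ?_
    have h3 : 0 ≤ t⁻¹ * (r - t) ^ 2 := by positivity
    have h4 : t⁻¹ * (r - t) ^ 2 = t⁻¹ * r ^ 2 - 2 * r + t := by field_simp; ring
    linarith
  refine le_of_forall_pos_le_add fun ε hε => ?_
  set r := ‖complexify φ z‖ with hr
  have hr0 : 0 ≤ r := norm_nonneg _
  refine (key (r + ε) (by positivity)).trans ?_
  have h1 : (r + ε)⁻¹ * r ^ 2 ≤ r := by
    rw [inv_mul_le_iff₀ (by positivity)]
    nlinarith
  linarith

theorem idealModulus_le_of_forall (hx : 0 ≤ x) (hne : x ≠ 0) {z : complexIdeal x}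
    {u : orderIdeal x} (h : ∀ φ : orderIdeal x →ₗ[ℝ] ℝ,
      IsLatticeCharacter (orderIdealUnit hx) φ → ‖complexify φ z‖ ≤ φ u) : idealModulus z ≤ u :=
  le_of_forall_character hx hne fun φ hφ => by
    rw [← norm_complexify hx hne hφ]
    exact h φ hφ

theorem eq_of_forall_complexify_eq (hx : 0 ≤ x) (hne : x ≠ 0) {z w : complexIdeal x}
    (h : ∀ φ : orderIdeal x →ₗ[ℝ] ℝ, IsLatticeCharacter (orderIdealUnit hx) φ →
      complexify φ z = complexify φ w) : z = w := by
  have h1 : idealModulus (z - w) ≤ 0 := idealModulus_le_of_forall hx hne fun φ hφ => by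
    rw [map_sub, h φ hφ, sub_self, norm_zero, map_zero]
  have h2 : (z - w).1 = 0 := modulus_eq_zero (le_antisymm h1 (modulus_nonneg _))
  exact sub_eq_zero.1 (Subtype.ext h2)

theorem exists_complex_mul (hx : 0 ≤ x) (hne : x ≠ 0) (z w : complexIdeal x) :
    ∃ m : complexIdeal x, ∀ φ : orderIdeal x →ₗ[ℝ] ℝ,
      IsLatticeCharacter (orderIdealUnit hx) φ →
        complexify φ m = complexify φ z * complexify φ w := by
  obtain ⟨a, ha⟩ := exists_mul hx hne (idealRe z) (idealRe w)
  obtain ⟨b, hb⟩ := exists_mul hx hne (idealIm z) (idealIm w)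
  obtain ⟨c, hc⟩ := exists_mul hx hne (idealRe z) (idealIm w)
  obtain ⟨d, hd⟩ := exists_mul hx hne (idealIm z) (idealRe w)
  refine ⟨⟨⟨(a - b).1, (c + d).1⟩, (a - b).2, (c + d).2⟩, fun φ hφ => Complex.ext ?_ ?_⟩
  · rw [Complex.mul_re]
    refine (map_sub φ a b).trans ?_
    rw [ha φ hφ, hb φ hφ]; rfl
  · rw [Complex.mul_im]
    refine (map_add φ c d).trans ?_
    rw [hc φ hφ, hd φ hφ]; rfl

/-- Multiplication by an element of the complexified ideal, where the generator is the unit. -/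
noncomputable def idealMul (hx : 0 ≤ x) (hne : x ≠ 0) (z : complexIdeal x) :
    complexIdeal x →ₗ[ℂ] complexIdeal x where
  toFun w := Classical.choose (exists_complex_mul hx hne z w)
  map_add' w w' := eq_of_forall_complexify_eq hx hne fun φ hφ => by
    have h := fun w => Classical.choose_spec (exists_complex_mul hx hne z w) φ hφ
    rw [map_add, h, h, h, map_add, mul_add]
  map_smul' c w := eq_of_forall_complexify_eq hx hne fun φ hφ => by
    have h := fun w => Classical.choose_spec (exists_complex_mul hx hne z w) φ hφ
    rw [map_smul, h, h, map_smul, RingHom.id_apply, smul_eq_mul, smul_eq_mul]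
    ring

theorem complexify_idealMul (hx : 0 ≤ x) (hne : x ≠ 0) (z w : complexIdeal x)
    {φ : orderIdeal x →ₗ[ℝ] ℝ} (hφ : IsLatticeCharacter (orderIdealUnit hx) φ) :
    complexify φ (idealMul hx hne z w) = complexify φ z * complexify φ w :=
  Classical.choose_spec (exists_complex_mul hx hne z w) φ hφ

theorem norm_complexify_of_modulus_eq (hx : 0 ≤ x) (hne : x ≠ 0) {z : complexIdeal x}
    (hz : z.1.modulus = x) {φ : orderIdeal x →ₗ[ℝ] ℝ}
    (hφ : IsLatticeCharacter (orderIdealUnit hx) φ) : ‖complexify φ z‖ = 1 := by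
  rw [norm_complexify hx hne hφ, ← hφ.map_unit]
  congr 1
  exact Subtype.ext hz

/-- Multiplication by a unimodular element preserves absolute values at every character. The
resulting norm bound allows the extension by density. -/
theorem modulus_idealMul_le (hx : 0 ≤ x) (hne : x ≠ 0) {z : complexIdeal x}
    (hz : z.1.modulus = x) (w : complexIdeal x) :
    (idealMul hx hne z w).1.modulus ≤ w.1.modulus := by
  refine (idealModulus_le_of_forall hx hne (u := idealModulus w) fun φ hφ => ?_ : _)
  rw [complexify_idealMul hx hne z w hφ, norm_mul, norm_complexify_of_modulus_eq hx hne hz hφ,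
    one_mul, norm_complexify hx hne hφ]

theorem modulus_conj (z : LatticeComplexification F) : (conj z).modulus = z.modulus := by
  have h : ∀ z : LatticeComplexification F, (conj z).modulus ≤ z.modulus := fun z =>
    modulus_le fun θ => by
      have : (conj z).rot θ = z.rot (-θ) := by simp [rot, conj]
      rw [this]
      exact rot_le_modulus z _
  refine le_antisymm (h z) ?_
  have h1 := h (conj z)
  have h2 : conj (conj z) = z := by ext <;> simp [conj]
  rwa [h2] at h1

/-- Conjugation on the complexified ideal. -/
def idealConj (z : complexIdeal x) : complexIdeal x := ⟨conj z.1, z.2.1, neg_mem z.2.2⟩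

theorem complexify_idealConj (ψ : orderIdeal x →ₗ[ℝ] ℝ) (z : complexIdeal x) :
    complexify ψ (idealConj z) = starRingEnd ℂ (complexify ψ z) :=
  Complex.ext rfl (map_neg ψ (idealIm z))

theorem idealMul_conj_cancel (hx : 0 ≤ x) (hne : x ≠ 0) {z : complexIdeal x}
    (hz : z.1.modulus = x) (w : complexIdeal x) :
    idealMul hx hne z (idealMul hx hne (idealConj z) w) = w ∧
      idealMul hx hne (idealConj z) (idealMul hx hne z w) = w := by
  have h : ∀ φ : orderIdeal x →ₗ[ℝ] ℝ, IsLatticeCharacter (orderIdealUnit hx) φ →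
      complexify φ z * starRingEnd ℂ (complexify φ z) = 1 := fun φ hφ => by
    rw [Complex.mul_conj, Complex.normSq_eq_norm_sq,
      norm_complexify_of_modulus_eq hx hne hz hφ]
    norm_num
  constructor
  · refine eq_of_forall_complexify_eq hx hne fun φ hφ => ?_
    rw [complexify_idealMul hx hne _ _ hφ, complexify_idealMul hx hne _ _ hφ,
      complexify_idealConj, ← mul_assoc, h φ hφ, one_mul]
  · refine eq_of_forall_complexify_eq hx hne fun φ hφ => ?_
    rw [complexify_idealMul hx hne _ _ hφ, complexify_idealMul hx hne _ _ hφ,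
      complexify_idealConj, ← mul_assoc, mul_comm (starRingEnd ℂ _), h φ hφ, one_mul]

/-- A normalized positive functional that attains modulus one at a unimodular element is
multiplicative with respect to that element. -/
theorem complexify_idealMul_of_norm_eq_one (hx : 0 ≤ x) (hne : x ≠ 0) {z : complexIdeal x}
    (hz : z.1.modulus = x) {ψ : orderIdeal x →ₗ[ℝ] ℝ} (hψ : ∀ u w, u ≤ w → ψ u ≤ ψ w)
    (hψ1 : ψ (orderIdealUnit hx) = 1) (hα : ‖complexify ψ z‖ = 1) (w : complexIdeal x) :
    complexify ψ (idealMul hx hne z w) = complexify ψ z * complexify ψ w := by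
  set α := complexify ψ z with hαdef
  obtain ⟨c, hc0, hc⟩ := exists_abs_le_smul hx (idealModulus w)
  have hα2 : α.re * α.re + α.im * α.im = 1 := by
    rw [← Complex.normSq_apply, Complex.normSq_eq_norm_sq, hα, one_pow]
  -- The element `q` is the real part of `conj α * z`. Since `ψ q = |α| ^ 2 = 1`, the functional `ψ`
  -- vanishes on the unit minus `q`, while a character with value `β` at `z` maps that difference to
  -- `|β - α| ^ 2 / 2`.
  let q : orderIdeal x := α.re • idealRe z + α.im • idealIm z
  have hq : ψ q = 1 := by rw [re_mul_complexify, ← hαdef, hα2]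
  set m := idealMul hx hne z w - α • w with hm
  have key : ∀ ε : ℝ, 0 < ε → ‖complexify ψ m‖ ≤ 0 + c / 2 * ε := by
    intro ε hε
    -- The bound `|β - α| ≤ ε / 2 + |β - α| ^ 2 / (2 ε)` replaces a Cauchy–Schwarz argument: `s` is
    -- linear in `q`, dominates the modulus of `m`, and `ψ` annihilates its second term.
    let s : orderIdeal x :=
      c • ((ε / 2) • orderIdealUnit hx + ε⁻¹ • (orderIdealUnit hx - q))
    have hs : ψ s = 0 + c / 2 * ε := by
      rw [map_smul, map_add, map_smul, map_smul, map_sub, hψ1, hq, sub_self, smul_zero,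
        smul_eq_mul, smul_eq_mul]
      ring
    rw [← hs]
    refine (norm_complexify_le hψ m).trans (hψ _ _ ?_)
    refine idealModulus_le_of_forall hx hne fun φ hφ => ?_
    set β := complexify φ z with hβ
    have hβ1 : β.re * β.re + β.im * β.im = 1 := by
      rw [← Complex.normSq_apply, Complex.normSq_eq_norm_sq, hβ,
        norm_complexify_of_modulus_eq hx hne hz hφ, one_pow]
    have hφs : φ s = c * (ε / 2 + ε⁻¹ * (1 - (α.re * β.re + α.im * β.im))) := by
      rw [map_smul, map_add, map_smul, map_smul, map_sub, hφ.map_unit, re_mul_complexify, ← hβ,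
        smul_eq_mul, smul_eq_mul, smul_eq_mul, mul_one]
    have hw : ‖complexify φ w‖ ≤ c := by
      rw [norm_complexify hx hne hφ]
      exact (le_abs_self _).trans (abs_character_le hx hφ hc)
    have hβα : ‖β - α‖ ^ 2 = 2 * (1 - (α.re * β.re + α.im * β.im)) := by
      rw [Complex.sq_norm, Complex.normSq_apply, Complex.sub_re, Complex.sub_im]
      linarith
    have h1 : complexify φ m = (β - α) * complexify φ w := by
      rw [hm, map_sub, map_smul, complexify_idealMul hx hne z w hφ, smul_eq_mul, sub_mul]
    rw [h1, norm_mul, hφs, mul_comm]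
    refine mul_le_mul hw ?_ (norm_nonneg _) hc0
    have h2 : 0 ≤ ε⁻¹ * (‖β - α‖ - ε) ^ 2 := by positivity
    have h3 : ε⁻¹ * (‖β - α‖ - ε) ^ 2 = ε⁻¹ * ‖β - α‖ ^ 2 - 2 * ‖β - α‖ + ε := by
      field_simp; ring
    rw [h3, hβα] at h2
    linarith
  have h0 : ‖complexify ψ m‖ ≤ 0 := by
    refine le_of_forall_pos_le_add fun ε hε => ?_
    have hc1 : 0 < c + 1 := by linarith
    refine (key (ε / (c + 1)) (div_pos hε hc1)).trans ?_
    have h1 : c / 2 * (ε / (c + 1)) ≤ (c + 1) * (ε / (c + 1)) :=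
      mul_le_mul_of_nonneg_right (by linarith) (div_pos hε hc1).le
    rw [mul_div_cancel₀ _ hc1.ne'] at h1
    linarith
  have h1 := norm_le_zero_iff.1 h0
  rw [hm, map_sub, map_smul, smul_eq_mul] at h1
  exact sub_eq_zero.1 h1

end ComplexIdeal

end LatticeComplexification

/-! ### Eigenvalues, spectrum and intertwining operators -/

section SpectralSymmetry

variable {X : Type u} [NormedAddCommGroup X] [NormedSpace ℂ X] {T : X →L[ℂ] X}

theorem mem_pointSpectrum_iff {μ : ℂ} : μ ∈ pointSpectrum T ↔ ∃ z, z ≠ 0 ∧ T z = μ • z := by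
  constructor
  · intro h
    obtain ⟨z, hz⟩ := Module.End.HasEigenvalue.exists_hasEigenvector h
    exact ⟨z, hz.2, hz.apply_eq_smul⟩
  · rintro ⟨z, hz0, hz⟩
    exact Module.End.hasEigenvalue_of_hasEigenvector
      (Module.End.hasEigenvector_iff.2 ⟨Module.End.mem_eigenspace_iff.2 hz, hz0⟩)

theorem mem_spectrum_of_mem_pointSpectrum {μ : ℂ} (h : μ ∈ pointSpectrum T) :
    μ ∈ spectrum ℂ T := by
  obtain ⟨z, hz0, hz⟩ := mem_pointSpectrum_iff.1 h
  rw [spectrum.mem_iff]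
  rintro ⟨U, hU⟩
  refine hz0 ?_
  have h1 : (U : X →L[ℂ] X) z = 0 := by
    rw [hU, Algebra.algebraMap_eq_smul_one]
    change μ • z - T z = 0
    rw [hz, sub_self]
  have h2 : ((U⁻¹ : (X →L[ℂ] X)ˣ) : X →L[ℂ] X) ((U : X →L[ℂ] X) z) = z := by
    rw [← mul_apply_eq_comp, Units.inv_mul]; rfl
  rw [← h2, h1, map_zero]

theorem norm_le_one_of_mem_spectrum (hr : spectralRadius ℂ T = 1) {μ : ℂ}
    (h : μ ∈ spectrum ℂ T) : ‖μ‖ ≤ 1 := by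
  have h1 : (‖μ‖₊ : ENNReal) ≤ spectralRadius ℂ T := le_iSup₂ (α := ENNReal) μ h
  rw [hr] at h1
  exact_mod_cast h1

theorem mem_peripheralPointSpectrum_iff (hr : spectralRadius ℂ T = 1) {μ : ℂ} :
    μ ∈ peripheralPointSpectrum T ↔ μ ∈ pointSpectrum T ∧ ‖μ‖ = 1 := by
  constructor
  · rintro ⟨⟨-, h⟩, hμ⟩
    rw [hr, ENNReal.ofReal_eq_one] at h
    exact ⟨hμ, h⟩
  · rintro ⟨hμ, h⟩
    refine ⟨⟨mem_spectrum_of_mem_pointSpectrum hμ, ?_⟩, hμ⟩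
    rw [hr, h, ENNReal.ofReal_one]

variable {μ : ℂ} {V : X ≃L[ℂ] X}

theorem areSimilar_of_intertwine (hV : ∀ w, T (V w) = μ • V (T w)) : AreSimilar T (μ • T) := by
  refine ⟨V, ?_⟩
  ext w
  change μ • T w = V.symm (T (V w))
  rw [hV, map_smul, V.symm_apply_apply]

theorem image_spectrum_of_areSimilar (hμ : μ ≠ 0) (h : AreSimilar T (μ • T)) :
    (fun ν : ℂ => μ * ν) '' spectrum ℂ T = spectrum ℂ T := by
  obtain ⟨V, hV⟩ := h
  let U : (X →L[ℂ] X)ˣ :=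
    ⟨(V : X →L[ℂ] X), (V.symm : X →L[ℂ] X), by ext w; exact V.apply_symm_apply w,
      by ext w; exact V.symm_apply_apply w⟩
  have h1 : μ • T = ((U⁻¹ : (X →L[ℂ] X)ˣ) : X →L[ℂ] X) * T * (U : X →L[ℂ] X) := hV
  have h2 : spectrum ℂ (μ • T) = spectrum ℂ T := by
    rw [h1]
    exact spectrum.units_conjugate'
  have h3 := spectrum.unit_smul_eq_smul T (Units.mk0 μ hμ)
  rw [Units.smul_mk0, h2] at h3
  conv_rhs => rw [h3]
  rfl

/-- `V` turns an eigenvector for `ν` into one for `μ * ν`, and its inverse undoes this. -/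
theorem image_pointSpectrum_of_intertwine (hμ : μ ≠ 0) (hV : ∀ w, T (V w) = μ • V (T w)) :
    (fun ν : ℂ => μ * ν) '' pointSpectrum T = pointSpectrum T := by
  refine Set.Subset.antisymm ?_ ?_
  · rintro _ ⟨ν, hν, rfl⟩
    obtain ⟨z, hz0, hz⟩ := mem_pointSpectrum_iff.1 hν
    refine mem_pointSpectrum_iff.2 ⟨V z, V.map_ne_zero_iff.2 hz0, ?_⟩
    rw [hV, hz, map_smul, smul_smul]
  · intro ν hν
    obtain ⟨z, hz0, hz⟩ := mem_pointSpectrum_iff.1 hν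
    refine ⟨μ⁻¹ * ν, mem_pointSpectrum_iff.2 ⟨V.symm z, V.symm.map_ne_zero_iff.2 hz0, ?_⟩,
      mul_inv_cancel_left₀ hμ ν⟩
    have h1 := hV (V.symm z)
    rw [V.apply_symm_apply, hz] at h1
    apply V.injective
    rw [map_smul, V.apply_symm_apply, mul_smul, h1, smul_smul, inv_mul_cancel₀ hμ, one_smul]

end SpectralSymmetry

/-! ### The signum operator and the intertwining relation -/

namespace LatticeComplexification

variable {F : Type u} [NormedAddCommGroup F] [Lattice F] [HasSolidNorm F] [IsOrderedAddMonoid F]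
  [NormedSpace ℝ F] [IsOrderedModule ℝ F] [CompleteSpace F]

section Signum

variable {x : F}

/-- Multiplication by a unimodular element, as an equivalence of the complexified ideal. -/
noncomputable def idealMulEquiv (hx : 0 ≤ x) (hne : x ≠ 0) (z : complexIdeal x)
    (hz : z.1.modulus = x) : complexIdeal x ≃ₗ[ℂ] complexIdeal x :=
  { idealMul hx hne z with
    invFun := idealMul hx hne (idealConj z)
    left_inv := fun w => (idealMul_conj_cancel hx hne hz w).2
    right_inv := fun w => (idealMul_conj_cancel hx hne hz w).1 }

theorem denseRange_complexIdeal (hx : IsQuasiInterior (ofReal x)) :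
    DenseRange (complexIdeal x).subtype := by
  refine hx.2.mono ?_
  rintro y ⟨c, -, hy⟩
  exact ⟨⟨y, mem_complexIdeal_of_modulus_le hy⟩, rfl⟩

theorem norm_idealMul_le (hx : 0 ≤ x) (hne : x ≠ 0) {z : complexIdeal x}
    (hz : z.1.modulus = x) (w : complexIdeal x) :
    ‖(idealMul hx hne z w).1‖ ≤ 1 * ‖w.1‖ := by
  rw [one_mul, norm_eq, norm_eq]
  exact norm_le_norm_of_nonneg_of_le (modulus_nonneg _) (modulus_idealMul_le hx hne hz w)

/-- The signum operator of an element whose modulus is quasi-interior. -/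
noncomputable def signum (hx : IsQuasiInterior (ofReal x)) (hne : x ≠ 0) (z : complexIdeal x)
    (hz : z.1.modulus = x) : LatticeComplexification F ≃L[ℂ] LatticeComplexification F :=
  (idealMulEquiv hx.1.2 hne z hz).extend (complexIdeal x).subtype (complexIdeal x).subtype
    (denseRange_complexIdeal hx) ⟨1, norm_idealMul_le hx.1.2 hne hz⟩
    (denseRange_complexIdeal hx)
    ⟨1, norm_idealMul_le hx.1.2 hne (z := idealConj z) ((modulus_conj z.1).trans hz)⟩

theorem signum_apply (hx : IsQuasiInterior (ofReal x)) (hne : x ≠ 0) (z : complexIdeal x)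
    (hz : z.1.modulus = x) (w : complexIdeal x) :
    signum hx hne z hz w.1 = (idealMul hx.1.2 hne z w).1 :=
  LinearEquiv.extend_eq _ (complexIdeal x).subtype (complexIdeal x).subtype _ _ _ _ w

variable {T : LatticeComplexification F →L[ℂ] LatticeComplexification F}

/-- By density the relation need only be checked on the complexified ideal, and there at each
character `φ`. The functional `φ ∘ T` is positive and normalized because `x` is fixed, and has the
unimodular value `μ * φ z` at `z`. It is therefore multiplicative with respect to `z`: `φ (T (z w))
= μ * φ z * φ (T w)`. -/
theorem exists_intertwine (hT : IsPositiveOperator T) (hx : IsQuasiInterior (ofReal x))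
    (hne : x ≠ 0) (hfix : realPart T x = x) {z : LatticeComplexification F}
    (hz : z.modulus = x) {μ : ℂ} (hμ : ‖μ‖ = 1) (hTz : T z = μ • z) :
    ∃ V : LatticeComplexification F ≃L[ℂ] LatticeComplexification F,
      ∀ w, T (V w) = μ • V (T w) := by
  have hx0 : 0 ≤ x := hx.1.2
  have hR : ∀ u : F, 0 ≤ u → 0 ≤ realPart T u := fun _ => realPart_nonneg hT
  have hmap : ∀ u ∈ orderIdeal x, realPart T u ∈ orderIdeal x := by
    rintro u ⟨c, hc⟩
    have h1 : ∀ w : F, w ≤ c • x → realPart T w ≤ c • x := fun w hw => by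
      have := map_mono_of_nonneg hR hw
      rwa [map_smul, hfix] at this
    refine ⟨c, abs_le'.2 ⟨h1 u ((le_abs_self u).trans hc), ?_⟩⟩
    rw [← map_neg]
    exact h1 (-u) ((neg_le_abs u).trans hc)
  let RI : orderIdeal x →ₗ[ℝ] orderIdeal x := (realPart T : F →ₗ[ℝ] F).restrict hmap
  have hmapC : ∀ w ∈ complexIdeal x, T w ∈ complexIdeal x := fun w hw => by
    rw [apply_eq hT]
    exact ⟨hmap _ hw.1, hmap _ hw.2⟩
  let TI : complexIdeal x → complexIdeal x := fun w => ⟨T w.1, hmapC w.1 w.2⟩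
  have hTI : ∀ (φ : orderIdeal x →ₗ[ℝ] ℝ) (w : complexIdeal x),
      complexify φ (TI w) = complexify (φ ∘ₗ RI) w := by
    intro φ w
    have h1 : idealRe (TI w) = RI (idealRe w) := Subtype.ext (by
      change (T w.1).re = realPart T w.1.re
      rw [apply_eq hT])
    have h2 : idealIm (TI w) = RI (idealIm w) := Subtype.ext (by
      change (T w.1).im = realPart T w.1.im
      rw [apply_eq hT])
    exact Complex.ext (congrArg φ h1) (congrArg φ h2)
  let zI : complexIdeal x := ⟨z, mem_complexIdeal_of_modulus_le (c := 1) (by rw [hz, one_smul])⟩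
  have hzI : TI zI = μ • zI := Subtype.ext hTz
  have hzx : zI.1.modulus = x := hz
  refine ⟨signum hx hne zI hzx, fun w => ?_⟩
  set V := signum hx hne zI hzx with hV
  have hclosed : IsClosed {w | T (V w) = μ • V (T w)} :=
    isClosed_eq (T.continuous.comp V.continuous)
      ((V.continuous.comp T.continuous).const_smul μ)
  refine (denseRange_complexIdeal hx).induction_on (p := fun w => T (V w) = μ • V (T w)) w
    hclosed fun w => ?_
  have key : TI (idealMul hx0 hne zI w) = μ • idealMul hx0 hne zI (TI w) := by
    refine eq_of_forall_complexify_eq hx0 hne fun φ hφ => ?_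
    have hψz : complexify (φ ∘ₗ RI) zI = μ * complexify φ zI := by
      rw [← hTI, hzI, map_smul, smul_eq_mul]
    rw [hTI, map_smul, complexify_idealMul hx0 hne _ _ hφ, hTI, smul_eq_mul, ← mul_assoc, ← hψz]
    have hψ : ∀ u w : orderIdeal x, u ≤ w → (φ ∘ₗ RI) u ≤ (φ ∘ₗ RI) w := fun u w h => by
      have h1 : realPart T u.1 ≤ realPart T w.1 := map_mono_of_nonneg hR h
      have h2 : RI u ≤ RI w := h1
      exact hφ.mono h2
    refine complexify_idealMul_of_norm_eq_one hx0 hne hzx hψ ?_ ?_ w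
    · have h1 : RI (orderIdealUnit hx0) = orderIdealUnit hx0 := Subtype.ext hfix
      rw [LinearMap.comp_apply, h1, hφ.map_unit]
    · rw [hψz, norm_mul, hμ, one_mul, norm_complexify_of_modulus_eq hx0 hne hzx hφ]
  have h1 : V w.1 = (idealMul hx0 hne zI w).1 := signum_apply hx hne zI hzx w
  have h2 : V (T w.1) = (idealMul hx0 hne zI (TI w)).1 := signum_apply hx hne zI hzx (TI w)
  change T (V w.1) = μ • V (T w.1)
  rw [h1, h2]
  exact congrArg Subtype.val key

end Signum

/-! ### Peripheral eigenvectors, Jordan chains and positive eigenvectors -/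

section Eigenvectors

open Filter Topology

variable {T : LatticeComplexification F →L[ℂ] LatticeComplexification F}

theorem modulus_le_map_of_eigenvector (hT : IsPositiveOperator T) {μ : ℂ} (hμ : ‖μ‖ = 1)
    {z : LatticeComplexification F} (hz : T z = μ • z) : z.modulus ≤ realPart T z.modulus := by
  have h := modulus_map_le (fun _ => realPart_nonneg hT) z
  rwa [← apply_eq hT, hz, modulus_smul_of_norm_one hμ] at h

theorem HasSpreadAverages.map_modulus_eq (h : HasSpreadAverages (realPart T))
    (hT : IsPositiveOperator T) (hirr : IsIrreducibleOperator T) {μ : ℂ} (hμ : ‖μ‖ = 1)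
    {z : LatticeComplexification F} (hz : T z = μ • z) : realPart T z.modulus = z.modulus :=
  h.map_eq_of_le_map hT hirr (modulus_nonneg z) (modulus_le_map_of_eigenvector hT hμ hz)

/-- A positive operator acts separately on real and imaginary parts, so its fixed space is the
complexification of the real fixed line. -/
theorem HasSpreadAverages.eigenspace_one (h : HasSpreadAverages (realPart T))
    (hT : IsPositiveOperator T) (hirr : IsIrreducibleOperator T) {x : F} (hx0 : 0 ≤ x)
    (hne : x ≠ 0) (hx : realPart T x = x) :
    Module.End.eigenspace (T : LatticeComplexification F →ₗ[ℂ] LatticeComplexification F) 1 =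
      ℂ ∙ ofReal x := by
  ext w
  rw [Module.End.mem_eigenspace_iff, one_smul, Submodule.mem_span_singleton]
  change T w = w ↔ _
  constructor
  · intro hw
    rw [apply_eq hT] at hw
    have hre : realPart T w.re = w.re := (LatticeComplexification.ext_iff.1 hw).1
    have him : realPart T w.im = w.im := (LatticeComplexification.ext_iff.1 hw).2
    obtain ⟨t, ht⟩ := h.exists_eq_smul hT hirr hx0 hne hx hre
    obtain ⟨s, hs⟩ := h.exists_eq_smul hT hirr hx0 hne hx him
    refine ⟨⟨t, s⟩, LatticeComplexification.ext ?_ ?_⟩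
    · rw [smul_re, ht]; simp
    · rw [smul_im, hs]; simp
  · rintro ⟨c, rfl⟩
    rw [map_smul, apply_ofReal hT, hx]

/-- The additional factor `μ` on both sides avoids the exponent `n - 1`. -/
theorem pow_eigenvector {X : Type*} [NormedAddCommGroup X] [NormedSpace ℂ X] {S : X →L[ℂ] X}
    {μ : ℂ} {w y : X} (hw : S w = μ • w + y) (hy : S y = μ • y) (n : ℕ) :
    μ • (S ^ n) w = μ ^ (n + 1) • w + ((n : ℂ) * μ ^ n) • y := by
  induction n with
  | zero => simp
  | succ n ih =>
    have h1 : (S ^ (n + 1)) w = S ((S ^ n) w) := by rw [pow_succ', mul_apply_eq_comp]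
    rw [h1, ← map_smul, ih, map_add, map_smul, map_smul, hw, hy]
    push_cast
    module

/-- For a Jordan chain of length two, moduli in the formula for `T ^ n w` give `n |y| ≤ T ^ n |w| +
|w|`, and such linear growth is impossible unless `y = 0`. -/
theorem HasSpreadAverages.apply_eq_of_generalized (h : HasSpreadAverages (realPart T))
    (hT : IsPositiveOperator T) {μ : ℂ} (hμ : ‖μ‖ = 1) {w y : LatticeComplexification F}
    (hw : T w = μ • w + y) (hy : T y = μ • y) : y = 0 := by
  refine modulus_eq_zero (h.eq_zero_of_linear_growth (modulus_nonneg w) (modulus_nonneg y)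
    fun n => ?_)
  have hpow : ∀ k : ℕ, ‖μ ^ k‖ = 1 := fun k => by rw [norm_pow, hμ, one_pow]
  have h1 := pow_eigenvector hw hy n
  have h2 : (n : ℂ) • y = (μ ^ n)⁻¹ • (μ • (T ^ n) w + -(μ ^ (n + 1) • w)) := by
    have h0 : μ ^ n ≠ 0 := fun h0 => by simpa [h0] using hpow n
    rw [h1, add_neg_cancel_comm, smul_smul, mul_comm (n : ℂ), inv_mul_cancel_left₀ h0]
  have h3 : ((n : ℂ) • y).modulus = (n : ℝ) • y.modulus := by
    refine le_antisymm (by simpa using modulus_smul_le (n : ℂ) y) ?_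
    rcases Nat.eq_zero_or_pos n with rfl | hn
    · simp [modulus_nonneg]
    have hn0 : (n : ℂ) ≠ 0 := Nat.cast_ne_zero.2 hn.ne'
    have hn1 : (0 : ℝ) < n := Nat.cast_pos.2 hn
    have h4 := modulus_smul_le (n : ℂ)⁻¹ ((n : ℂ) • y)
    rw [smul_smul, inv_mul_cancel₀ hn0, one_smul, norm_inv, Complex.norm_natCast] at h4
    have h5 := smul_le_smul_of_nonneg_left h4 hn1.le
    rwa [smul_smul, mul_inv_cancel₀ hn1.ne', one_smul] at h5
  rw [← h3, h2, modulus_smul_of_norm_one (by rw [norm_inv, hpow, inv_one])]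
  refine (modulus_add_le _ _).trans ?_
  rw [modulus_neg, modulus_smul_of_norm_one hμ, modulus_smul_of_norm_one (hpow _),
    pow_apply_eq hT]
  exact add_le_add_left (modulus_map_le
    (fun _ => pow_nonneg_of_nonneg (fun _ => realPart_nonneg hT) n) w) _

theorem apply_eq_zero_of_pow_apply_eq_zero {K M : Type*} [Semiring K] [AddCommMonoid M]
    [Module K M] {f : Module.End K M} (hf : ∀ w, f (f w) = 0 → f w = 0) (k : ℕ) {w : M}
    (h : (f ^ k) w = 0) : f w = 0 := by
  induction k generalizing w with
  | zero =>
    have : w = 0 := h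
    rw [this, map_zero]
  | succ k ih =>
    rw [pow_succ, Module.End.mul_apply] at h
    exact hf w (ih h)

theorem HasSpreadAverages.maxGenEigenspace_eq (h : HasSpreadAverages (realPart T))
    (hT : IsPositiveOperator T) {μ : ℂ} (hμ : ‖μ‖ = 1) :
    Module.End.maxGenEigenspace
        (T : LatticeComplexification F →ₗ[ℂ] LatticeComplexification F) μ =
      Module.End.eigenspace
        (T : LatticeComplexification F →ₗ[ℂ] LatticeComplexification F) μ := by
  refine le_antisymm (fun w hw => ?_) Module.End.eigenspace_le_maxGenEigenspace
  obtain ⟨k, hk⟩ := (Module.End.mem_maxGenEigenspace _ _ _).1 hw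
  rw [Module.End.mem_eigenspace_iff]
  refine sub_eq_zero.1 (apply_eq_zero_of_pow_apply_eq_zero (fun y hy => ?_) k hk)
  change T (T y - μ • y) - μ • (T y - μ • y) = 0 at hy
  change T y - μ • y = 0
  exact h.apply_eq_of_generalized hT hμ (add_sub_cancel (μ • y) (T y)).symm (sub_eq_zero.1 hy)

/-- Positivity makes `ν` real and non-negative, and the spectral radius bounds it by one. If `ν <
1`, the orbit `ν ^ k z` would tend to zero. -/
theorem HasSpreadAverages.eq_one_of_pos_eigenvector (h : HasSpreadAverages (realPart T))
    (hr : spectralRadius ℂ T = 1) (hT : IsPositiveOperator T) (hirr : IsIrreducibleOperator T)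
    {x : F} (hx0 : 0 ≤ x) (hne : x ≠ 0) (hx : realPart T x = x) {ν : ℂ}
    {z : LatticeComplexification F} (hz : z.Pos) (hTz : T z = ν • z) : ν = 1 := by
  obtain ⟨⟨him, hre⟩, hz0⟩ := hz
  have hz1 : z.re ≠ 0 := fun h0 => hz0 (LatticeComplexification.ext h0 him)
  have hν : ‖ν‖ ≤ 1 := norm_le_one_of_mem_spectrum hr
    (mem_spectrum_of_mem_pointSpectrum (mem_pointSpectrum_iff.2 ⟨z, hz0, hTz⟩))
  have h1 := hTz
  rw [apply_eq hT] at h1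
  have h2 : realPart T z.re = ν.re • z.re := by
    have := congrArg LatticeComplexification.re h1
    rwa [smul_re, him, smul_zero, sub_zero] at this
  have h3 : ν.im = 0 := by
    have : realPart T z.im = (ν • z).im := congrArg LatticeComplexification.im h1
    rw [smul_im, him, smul_zero, zero_add, map_zero] at this
    exact (smul_eq_zero.1 this.symm).resolve_right hz1
  have hν0 : 0 ≤ ν.re := by
    by_contra hlt
    have h4 : 0 ≤ ν.re • z.re := h2 ▸ realPart_nonneg hT hre
    have h5 := smul_nonpos_of_nonpos_of_nonneg (not_le.1 hlt).le hre
    rcases smul_eq_zero.1 (le_antisymm h5 h4) with h6 | h6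
    · exact hlt h6.ge
    · exact hz1 h6
  refine Complex.ext ?_ h3
  rw [Complex.one_re]
  refine ((Complex.re_le_norm ν).trans hν).eq_of_not_lt fun hlt => ?_
  refine h.not_tendsto_zero hT hirr hx0 hx.ge hne hre hz1 ?_
  have h4 : ∀ k : ℕ, (realPart T ^ k) z.re = ν.re ^ k • z.re := fun k => by
    induction k with
    | zero => simp
    | succ k ih =>
      rw [pow_succ', mul_apply_eq_comp, ih, map_smul, h2, smul_smul, pow_succ]
  simp only [h4]
  simpa using (tendsto_pow_atTop_nhds_zero_of_lt_one hν0 hlt).smul_const z.re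

end Eigenvectors

end LatticeComplexification

/-! ### Assembly of the assertions -/

theorem mainTheorem6 {F : Type u} [NormedAddCommGroup F] [Lattice F] [HasSolidNorm F]
    [IsOrderedAddMonoid F] [NormedSpace ℝ F] [IsOrderedModule ℝ F] [CompleteSpace F]
    (T : LatticeComplexification F →L[ℂ] LatticeComplexification F)
    (hr : spectralRadius ℂ T = 1)
    (hpos : LatticeComplexification.IsPositiveOperator T)
    (hirr : LatticeComplexification.IsIrreducibleOperator T)
    (hper : (peripheralPointSpectrum T).Nonempty)
    (hWS : IsWSBounded.{u, v} T) :
    -- (a)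
    (∀ x : LatticeComplexification F, x.Pos →
      ¬ Filter.Tendsto (fun k : ℕ => (T ^ k) x) Filter.atTop (nhds 0)) ∧
    -- (b)
    (∀ μ ∈ peripheralPointSpectrum T,
      ∀ z ∈ Module.End.eigenspace (T : LatticeComplexification F →ₗ[ℂ] LatticeComplexification F) μ,
        LatticeComplexification.ofReal z.modulus ∈
          Module.End.eigenspace
            (T : LatticeComplexification F →ₗ[ℂ] LatticeComplexification F) 1) ∧
    -- (c)
    ((1 : ℂ) ∈ pointSpectrum T ∧
      Module.finrank ℂ (Module.End.eigenspace
        (T : LatticeComplexification F →ₗ[ℂ] LatticeComplexification F) 1) = 1 ∧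
      LatticeComplexification.IsSublattice (Module.End.eigenspace
        (T : LatticeComplexification F →ₗ[ℂ] LatticeComplexification F) 1) ∧
      ∃ x : LatticeComplexification F, x.IsQuasiInterior ∧
        Module.End.eigenspace
          (T : LatticeComplexification F →ₗ[ℂ] LatticeComplexification F) 1 = ℂ ∙ x) ∧
    -- (d)
    (∀ μ ∈ peripheralPointSpectrum T,
      AreSimilar T (μ • T) ∧
      (fun ν : ℂ => μ * ν) '' spectrum ℂ T = spectrum ℂ T ∧
      (fun ν : ℂ => μ * ν) '' pointSpectrum T = pointSpectrum T) ∧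
    -- (e)
    (∃ G : Subgroup Circle,
      (fun c : Circle => (c : ℂ)) '' (G : Set Circle) = peripheralPointSpectrum T) ∧
    -- (f)
    (∀ μ ∈ peripheralPointSpectrum T,
      Module.finrank ℂ (Module.End.eigenspace
        (T : LatticeComplexification F →ₗ[ℂ] LatticeComplexification F) μ) = 1 ∧
      Module.finrank ℂ (Module.End.maxGenEigenspace
        (T : LatticeComplexification F →ₗ[ℂ] LatticeComplexification F) μ) = 1) ∧
    -- (g)
    (∀ μ : ℂ, (∃ z : LatticeComplexification F, z.Pos ∧ T z = μ • z) ↔ μ = 1) := by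
  open LatticeComplexification in
  have h : HasSpreadAverages (realPart T) := hasSpreadAverages hr hpos hWS
  have hiff : ∀ {μ : ℂ}, μ ∈ peripheralPointSpectrum T ↔ μ ∈ pointSpectrum T ∧ ‖μ‖ = 1 :=
    mem_peripheralPointSpectrum_iff hr
  obtain ⟨μ₀, hμ₀⟩ := hper
  obtain ⟨z₀, hz₀, hTz₀⟩ := mem_pointSpectrum_iff.1 (hiff.1 hμ₀).1
  -- The modulus of one peripheral eigenvector supplies the nonzero positive fixed vector used in
  -- all the assertions.
  set x := z₀.modulus with hxdef
  have hx0 : 0 ≤ x := modulus_nonneg z₀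
  have hne : x ≠ 0 := fun h0 => hz₀ (modulus_eq_zero h0)
  have hx : realPart T x = x := h.map_modulus_eq hpos hirr (hiff.1 hμ₀).2 hTz₀
  have hquasi : ∀ y : F, 0 ≤ y → y ≠ 0 → realPart T y = y → IsQuasiInterior (ofReal y) :=
    fun y hy0 hyne hy => isQuasiInterior_ofReal hy0 fun u hu =>
      hirr.exists_norm_posPart_le hpos hy0 hyne hy hu
  have heig := h.eigenspace_one hpos hirr hx0 hne hx
  have hxC : ofReal x ≠ 0 := fun h0 => hne (congrArg LatticeComplexification.re h0)
  have hTx : T (ofReal x) = (1 : ℂ) • ofReal x := by rw [apply_ofReal hpos, hx, one_smul]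
  have hone : (1 : ℂ) ∈ pointSpectrum T := mem_pointSpectrum_iff.2 ⟨ofReal x, hxC, hTx⟩
  have hV : ∀ μ ∈ peripheralPointSpectrum T,
      ∃ V : LatticeComplexification F ≃L[ℂ] LatticeComplexification F,
        ∀ w, T (V w) = μ • V (T w) := fun μ hμ => by
    obtain ⟨hμp, hμ1⟩ := hiff.1 hμ
    obtain ⟨z, hz0, hz⟩ := mem_pointSpectrum_iff.1 hμp
    have hy := h.map_modulus_eq hpos hirr hμ1 hz
    have hyne : z.modulus ≠ 0 := fun h0 => hz0 (modulus_eq_zero h0)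
    exact exists_intertwine hpos (hquasi _ (modulus_nonneg z) hyne hy) hyne hy rfl hμ1 hz
  have hμne : ∀ {μ : ℂ}, μ ∈ peripheralPointSpectrum T → μ ≠ 0 := fun hμ h0 => by
    have := (hiff.1 hμ).2
    simp [h0] at this
  have himage : ∀ μ ∈ peripheralPointSpectrum T,
      (fun ν : ℂ => μ * ν) '' pointSpectrum T = pointSpectrum T := fun μ hμ => by
    obtain ⟨V, hVT⟩ := hV μ hμ
    exact image_pointSpectrum_of_intertwine (hμne hμ) hVT
  have hb : ∀ μ ∈ peripheralPointSpectrum T, ∀ z ∈ Module.End.eigenspace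
      (T : LatticeComplexification F →ₗ[ℂ] LatticeComplexification F) μ,
      ofReal z.modulus ∈ Module.End.eigenspace
        (T : LatticeComplexification F →ₗ[ℂ] LatticeComplexification F) 1 := fun μ hμ z hz => by
    have hy := h.map_modulus_eq hpos hirr (hiff.1 hμ).2 (Module.End.mem_eigenspace_iff.1 hz)
    rw [Module.End.mem_eigenspace_iff, one_smul]
    change T (ofReal z.modulus) = _
    rw [apply_ofReal hpos, hy]
  have hone' : (1 : ℂ) ∈ peripheralPointSpectrum T := hiff.2 ⟨hone, norm_one⟩
  refine ⟨fun y hy hlim => ?_, hb, ⟨hone, ?_, ⟨?_, ?_, hb 1 hone'⟩, ofReal x,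
    hquasi x hx0 hne hx, heig⟩, fun μ hμ => ?_, ?_, fun μ hμ => ?_, fun ν => ⟨?_, ?_⟩⟩
  · obtain ⟨⟨him, hre⟩, hy0⟩ := hy
    refine h.not_tendsto_zero hpos hirr hx0 hx.ge hne hre
      (fun h0 => hy0 (LatticeComplexification.ext h0 him)) ?_
    refine squeeze_zero_norm (fun k => ?_) (tendsto_zero_iff_norm_tendsto_zero.1 hlim)
    have := norm_re_le ((T ^ k) y)
    rwa [pow_apply_eq hpos] at this ⊢
  · rw [heig, finrank_span_singleton hxC]
  · have : ((Module.End.eigenspace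
        (T : LatticeComplexification F →ₗ[ℂ] LatticeComplexification F) 1 :
        Submodule ℂ (LatticeComplexification F)) : Set (LatticeComplexification F)) =
        {w | T w = w} := by
      ext w
      rw [SetLike.mem_coe, Module.End.mem_eigenspace_iff, one_smul]
      rfl
    rw [this]
    exact isClosed_eq T.continuous continuous_id
  · intro z hz
    rw [heig, Submodule.mem_span_singleton] at hz ⊢
    obtain ⟨c, rfl⟩ := hz
    refine ⟨starRingEnd ℂ c, LatticeComplexification.ext ?_ ?_⟩
    · simp [conj, smul_re]
    · simp [conj, smul_im]
  · obtain ⟨V, hVT⟩ := hV μ hμ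
    have hsim := areSimilar_of_intertwine hVT
    exact ⟨hsim, image_spectrum_of_areSimilar (hμne hμ) hsim, himage μ hμ⟩
  · refine ⟨{ carrier := {c | (c : ℂ) ∈ peripheralPointSpectrum T}
              mul_mem' := fun {c d} hc hd => ?_
              one_mem' := hone'
              inv_mem' := fun {c} hc => ?_ }, ?_⟩
    · refine hiff.2 ⟨?_, Circle.norm_coe _⟩
      -- Multiplication by `c` maps the point spectrum onto itself: this gives products, and below,
      -- solving `c * ν = 1` in the point spectrum gives inverses.
      rw [← himage c hc]
      exact ⟨d, (hiff.1 hd).1, rfl⟩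
    · refine hiff.2 ⟨?_, Circle.norm_coe _⟩
      obtain ⟨ν, hν, hcν⟩ := (himage c hc).symm ▸ hone
      rwa [Circle.coe_inv, ← eq_inv_of_mul_eq_one_right hcν]
    · ext ν
      constructor
      · rintro ⟨c, hc, rfl⟩
        exact hc
      · intro hν
        exact ⟨⟨ν, mem_sphere_zero_iff_norm.2 (hiff.1 hν).2⟩, hν, rfl⟩
  · rw [h.maxGenEigenspace_eq hpos (hiff.1 hμ).2, and_self]
    obtain ⟨V, hVT⟩ := hV μ hμ
    -- `V` carries the fixed line onto the eigenspace of `μ`.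
    have hspan : Module.End.eigenspace
        (T : LatticeComplexification F →ₗ[ℂ] LatticeComplexification F) μ =
        ℂ ∙ V (ofReal x) := by
      ext w
      rw [Module.End.mem_eigenspace_iff, Submodule.mem_span_singleton]
      change T w = μ • w ↔ _
      constructor
      · intro hw
        have h1 := hVT (V.symm w)
        rw [V.apply_symm_apply, hw] at h1
        have h2 : V.symm w ∈ Module.End.eigenspace
            (T : LatticeComplexification F →ₗ[ℂ] LatticeComplexification F) 1 := by
          rw [Module.End.mem_eigenspace_iff, one_smul]
          apply V.injective
          rw [V.apply_symm_apply]
          exact (smul_right_injective _ (hμne hμ) h1).symm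
        rw [heig, Submodule.mem_span_singleton] at h2
        obtain ⟨c, hc⟩ := h2
        exact ⟨c, by rw [← map_smul, hc, V.apply_symm_apply]⟩
      · rintro ⟨c, rfl⟩
        rw [map_smul, hVT, hTx, one_smul, smul_comm]
    have hVx : V (ofReal x) ≠ 0 := V.map_ne_zero_iff.2 hxC
    rw [hspan]
    exact finrank_span_singleton hVx
  · rintro ⟨z, hz, hTz⟩
    exact h.eq_one_of_pos_eigenvector hr hpos hirr hx0 hne hx hz hTz
  · rintro rfl
    exact ⟨ofReal x, ⟨nonneg_ofReal hx0, hxC⟩, hTx⟩
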